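/- Let $k$ be an algebraically closed field of characteristic $p>0$, let $X$ be a proper scheme over $k$, and let $F\colon X\to X$ be the absolute Frobenius morphism (the identity on the underlying space, and $s\mapsto s^p$ on sections of $\mathcal{O}_X$). Suppose that the $\mathcal{O}_X$-module $F_*\mathcal{O}_X$ is isomorphic to a direct sum of invertible sheaves on $X$. Then $X$ is smooth over $k$ and $X$ is Frobenius split, that is, the canonical map $F^\sharp\colon \mathcal{O}_X\to F_*\mathcal{O}_X$ is a split monomorphism of $\mathcal{O}_X$-modules. -/

import Mathlib

open CategoryTheory Limits AlgebraicGeometry Opposite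

universe u

namespace FrobeniusSplitting

/-- The `p`-th power map of a commutative ring in which the prime `p` is zero
(the zero ring is allowed). -/
def powRingHom (R : Type u) [CommRing R] (p : ℕ) (hp : p.Prime) (h : (p : R) = 0) : R →+* R where
  toFun x := x ^ p
  map_one' := one_pow p
  map_mul' x y := mul_pow x y p
  map_zero' := zero_pow hp.ne_zero
  map_add' x y := by
    rw [add_pow_prime_eq hp, h]
    ring

/-- A scheme of characteristic `p`: the integer `p` is zero in the structure sheaf. -/
def IsOfChar (X : Scheme.{u}) (p : ℕ) : Prop := (p : Γ(X, ⊤)) = 0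

theorem IsOfChar.section_eq_zero {X : Scheme.{u}} {p : ℕ} (h : IsOfChar X p) (U : X.Opens) :
    (p : Γ(X, U)) = 0 := by
  have := congrArg (X.presheaf.map (homOfLE (le_top : U ≤ ⊤)).op).hom h
  rwa [map_natCast, map_zero] at this

/-- A scheme over a field of characteristic `p` is a scheme of characteristic `p`. -/
theorem IsOfChar.of_field {k : Type u} [Field k] {p : ℕ} [CharP k p] {X : Scheme.{u}}
    (f : X ⟶ Spec (CommRingCat.of k)) : IsOfChar X p := by
  let φ : k →+* Γ(X, ⊤) := ((Scheme.ΓSpecIso (CommRingCat.of k)).inv ≫ f.appTop).hom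
  have h : φ (p : k) = φ 0 := by rw [CharP.cast_eq_zero]
  rwa [map_natCast, map_zero] at h

/-- The absolute Frobenius of a scheme of characteristic `p` as a morphism of presheafed spaces. -/
def absFrobeniusPre (X : Scheme.{u}) (p : ℕ) (hp : p.Prime) (hX : IsOfChar X p) :
    X.toPresheafedSpace.Hom X.toPresheafedSpace where
  base := 𝟙 _
  c :=
    { app := fun U => CommRingCat.ofHom
        (powRingHom Γ(X, U.unop) p hp (hX.section_eq_zero U.unop))
      naturality := by
        intro U V i
        ext s
        exact (map_pow (X.presheaf.map i).hom s p).symm }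

/-- The absolute Frobenius morphism `F : X ⟶ X` of a scheme of characteristic `p`: the identity on
the underlying space, and `s ↦ s ^ p` on sections of the structure sheaf. -/
def absFrobenius (X : Scheme.{u}) (p : ℕ) (hp : p.Prime) (hX : IsOfChar X p) : X ⟶ X where
  toHom := absFrobeniusPre X p hp hX
  prop := by
    intro x
    constructor
    intro a ha
    obtain ⟨U, hxU, s, rfl⟩ := TopCat.Presheaf.exists_germ_eq X.presheaf a
    have key : ((absFrobeniusPre X p hp hX).stalkMap x).hom (X.presheaf.germ U _ hxU s) =
        X.presheaf.germ U x hxU s ^ p :=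
      (congr($(PresheafedSpace.stalkMap_germ (absFrobeniusPre X p hp hX) U x hxU) s)).trans
        (map_pow (X.presheaf.germ U x hxU).hom s p)
    have hu : IsUnit (X.presheaf.germ U x hxU s ^ p) := key ▸ ha
    exact (isUnit_pow_iff hp.ne_zero).1 hu

theorem absFrobenius_base (X : Scheme.{u}) (p : ℕ) (hp : p.Prime) (hX : IsOfChar X p) (x : X) :
    absFrobenius X p hp hX x = x := rfl

theorem absFrobenius_app (X : Scheme.{u}) (p : ℕ) (hp : p.Prime) (hX : IsOfChar X p)
    (U : X.Opens) (s : Γ(X, U)) : (absFrobenius X p hp hX).app U s = s ^ p := rfl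

/-- The structure sheaf `𝒪_X` as a module over itself. -/
noncomputable def structureModule (X : Scheme.{u}) : X.Modules :=
  SheafOfModules.unit X.ringCatSheaf

/-- An invertible sheaf on `X`: an `𝒪_X`-module that is locally isomorphic to `𝒪_X`. -/
def IsInvertible {X : Scheme.{u}} (L : X.Modules) : Prop :=
  ∀ x : X, ∃ U : X.Opens, x ∈ U ∧ Nonempty (L.restrict U.ι ≅ structureModule (U : Scheme.{u}))

/-- An `𝒪_X`-module is a direct sum of invertible sheaves if it is isomorphic to the direct sum
of some (possibly infinite or empty) family of invertible sheaves. -/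
def IsDirectSumOfInvertibles {X : Scheme.{u}} (M : X.Modules) : Prop :=
  ∃ (ι : Type u) (L : ι → X.Modules), (∀ i, IsInvertible (L i)) ∧ Nonempty (M ≅ ∐ L)

/-- The canonical `𝒪_Y`-linear map `f^♯ : 𝒪_Y ⟶ f_* 𝒪_X` of a morphism of schemes `f : X ⟶ Y`. -/
noncomputable def sharp {X Y : Scheme.{u}} (f : X ⟶ Y) :
    structureModule Y ⟶ (Scheme.Modules.pushforward f).obj (structureModule X) :=
  SheafOfModules.unitToPushforwardObjUnit f.toRingCatSheafHom

theorem sharp_app {X Y : Scheme.{u}} (f : X ⟶ Y) (U : Y.Opens) (s : Γ(Y, U)) :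
    (Scheme.Modules.Hom.app (sharp f) U).hom s = f.app U s := rfl

/-- `X` is Frobenius split: `F^♯ : 𝒪_X ⟶ F_* 𝒪_X` is a split monomorphism of `𝒪_X`-modules. -/
def IsFrobeniusSplit (X : Scheme.{u}) (p : ℕ) (hp : p.Prime) (hX : IsOfChar X p) : Prop :=
  IsSplitMono (sharp (absFrobenius X p hp hX))

end FrobeniusSplitting

/-! Smoothness is a form of Kunz's theorem. On a nonempty `X` only finitely many summands occur,
since the Frobenius is finite over affine opens, so locally $F_*\mathcal{O}_X$ is finite free. At a
closed point let $x_i$ be minimal generators of the maximal ideal. A relation among the $x_i^p$ is a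
relation among the $x_i$ in the free module given by Frobenius, so the $x_i^p$ are independent in
Lech's sense (`lechIndependent_pow`). Lech's exponent-lowering argument and flatness then make the
monomials with all exponents below $p$ linearly independent, and Nakayama makes them span
(`exists_pBasis`). Such a $p$-basis gives infinitesimal lifting directly: $p$-th powers are
insensitive to a square-zero ideal, so the lift is prescribed linearly on the basis
(`formallySmooth_of_pBasis`). Openness of the smooth locus does the rest.

For the splitting, let $e_i$ be the projection of $1$ to the $i$-th summand, viewed in
$\Gamma(X,\mathcal{O}_X)$. This ring is reduced and, by properness, integral over $k$, so all its
elements are $p$-th powers (`exists_pow_eq_of_isIntegral`). As projections are linear over $p$-th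
powers, each $e_i$ is idempotent. Locally one $e_i$ is $1$ and the others vanish; there $1$
generates the $i$-th summand, whose sections are therefore exactly the $p$-th powers. Hence $\sum_i
e_i\,\mathrm{pr}_i$ fixes $1$ and takes values in the image of $F^\sharp$, so it factors through a
retraction (`isFrobeniusSplit_of_summands`). -/

namespace FrobeniusSplitting

/-! ### Frobenius pushforward of a ring, and its localization -/

section Twist

variable {A : Type*} [CommRing A]

/-- The ring `A`, regarded as an algebra over itself through the endomorphism `φ`. -/
def Twist (_φ : A →+* A) : Type _ := A

namespace Twist

variable (φ : A →+* A)

instance : CommRing (Twist φ) := inferInstanceAs (CommRing A)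

instance : Algebra A (Twist φ) := φ.toAlgebra

/-- The identity map from `A` to its twist. -/
def of : A ≃+* Twist φ := RingEquiv.refl A

theorem smul_of (a b : A) : a • of φ b = of φ (φ a * b) := rfl

theorem algebraMap_eq (a : A) : algebraMap A (Twist φ) a = of φ (φ a) := rfl

end Twist

open Twist

/-- Localization commutes with twisting by the `p`-th power map. -/
theorem Twist.isLocalizedModule {R A : Type*} [CommRing R] [CommRing A] [Algebra R A]
    (S : Submonoid R) [IsLocalization S A] {p : ℕ} (hp : p ≠ 0) (φ : R →+* R) (ψ : A →+* A)
    (hφ : ∀ a, φ a = a ^ p) (hψ : ∀ a, ψ a = a ^ p) [Module R (Twist ψ)]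
    [IsScalarTower R A (Twist ψ)] (l : Twist φ →ₗ[R] Twist ψ)
    (hl : ∀ a, l (of φ a) = of ψ (algebraMap R A a)) : IsLocalizedModule S l where
  map_units s := by
    rw [Module.End.isUnit_iff]
    have hs : IsUnit (algebraMap R A s) := IsLocalization.map_units A s
    have key : ∀ b, (algebraMap R (Module.End R (Twist ψ))) (s : R) (of ψ b) =
        of ψ (algebraMap R A s ^ p * b) := by
      intro b
      rw [Module.algebraMap_end_apply, ← algebraMap_smul A, smul_of, hψ]
    constructor
    · intro a b hab
      obtain ⟨a, rfl⟩ := (of ψ).surjective a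
      obtain ⟨b, rfl⟩ := (of ψ).surjective b
      rw [key, key] at hab
      exact congrArg _ ((hs.pow p).mul_left_cancel ((of ψ).injective hab))
    · intro b
      obtain ⟨b, rfl⟩ := (of ψ).surjective b
      obtain ⟨u, hu⟩ := (hs.pow p)
      refine ⟨of ψ (↑u⁻¹ * b), ?_⟩
      rw [key, ← hu, Units.mul_inv_cancel_left]
  surj b := by
    obtain ⟨b, rfl⟩ := (of ψ).surjective b
    obtain ⟨⟨r, s⟩, h⟩ := IsLocalization.surj S b
    -- Since `s` acts on the twist as $s^p$, the fraction $r/s$ is rewritten as $rs^{p-1}/s^p$.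
    refine ⟨⟨of φ (r * (s : R) ^ (p - 1)), s⟩, ?_⟩
    rw [hl, Submonoid.smul_def, ← algebraMap_smul A, smul_of, hψ]
    dsimp only at h ⊢
    rw [map_mul (algebraMap R A), ← h, map_pow]
    obtain ⟨q, rfl⟩ := Nat.exists_eq_succ_of_ne_zero hp
    simp only [Nat.succ_eq_add_one, Nat.add_sub_cancel]
    congr 1
    ring
  exists_of_eq {a b} hab := by
    obtain ⟨a, rfl⟩ := (of φ).surjective a
    obtain ⟨b, rfl⟩ := (of φ).surjective b
    rw [hl, hl] at hab
    obtain ⟨s, hs⟩ := (IsLocalization.eq_iff_exists S A).1 ((of ψ).injective hab)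
    refine ⟨s, ?_⟩
    rw [Submonoid.smul_def, Submonoid.smul_def, smul_of, smul_of, hφ]
    obtain ⟨q, rfl⟩ := Nat.exists_eq_succ_of_ne_zero hp
    rw [pow_succ, mul_assoc, hs, mul_assoc]

theorem Twist.finite_free_of_isLocalization {R A : Type*} [CommRing R] [CommRing A] [Algebra R A]
    (S : Submonoid R) [IsLocalization S A] {p : ℕ} (hp : p ≠ 0) (φ : R →+* R) (ψ : A →+* A)
    (hφ : ∀ a, φ a = a ^ p) (hψ : ∀ a, ψ a = a ^ p) [Module.Finite R (Twist φ)]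
    [Module.Free R (Twist φ)] : Module.Finite A (Twist ψ) ∧ Module.Free A (Twist ψ) := by
  let : Module R (Twist ψ) := Module.compHom _ (algebraMap R A)
  have : IsScalarTower R A (Twist ψ) := ⟨fun r a m => by
    rw [Algebra.smul_def r a, mul_smul]; rfl⟩
  let l : Twist φ →ₗ[R] Twist ψ :=
    { toFun := fun a => of ψ (algebraMap R A ((of φ).symm a))
      map_add' := fun a b => by simp
      map_smul' := fun r a => by
        obtain ⟨a, rfl⟩ := (of φ).surjective a
        rw [smul_of, hφ, RingHom.id_apply, ← algebraMap_smul A, smul_of, hψ]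
        simp }
  have := Twist.isLocalizedModule S hp φ ψ hφ hψ l (fun a => rfl)
  exact ⟨Module.Finite.of_isLocalizedModule S l, Module.free_of_isLocalizedModule S l⟩

end Twist

/-! ### Formal smoothness from a $p$-basis -/

section PBasis

open Twist

/-- An algebra over a perfect field that has a `p`-basis is formally smooth. -/
theorem formallySmooth_of_pBasis {k A : Type u} [Field k] [CommRing A] [Algebra k A] {p : ℕ}
    (hp : p.Prime) [CharP k p] (hk : ∀ c : k, ∃ d, d ^ p = c) (φ : A →+* A)
    (hφ : ∀ a, φ a = a ^ p) {ι : Type*} [Fintype ι] (x : ι → A)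
    (b : Module.Basis (ι → Fin p) A (Twist φ)) (hb : ∀ a, b a = of φ (∏ i, x i ^ (a i : ℕ))) :
    Algebra.FormallySmooth k A := by
  rw [Algebra.FormallySmooth.iff_comp_surjective]
  intro B _ _ I hI g
  have hpB : (p : B) = 0 := by
    rw [← map_natCast (algebraMap k B), CharP.cast_eq_zero, map_zero]
  -- As $I^2=0$ and $p\ge 2$, the $p$-th power map of `B` kills `I`, so it descends to $B/I$ without
  -- any choice of lifts.
  let ψ₀ : B ⧸ I →+* B := Ideal.Quotient.lift I (powRingHom B p hp hpB) fun c hc => by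
    have h2 : c ^ 2 ∈ I ^ 2 := Ideal.pow_mem_pow hc 2
    rw [hI, Ideal.mem_bot] at h2
    change c ^ p = 0
    exact pow_eq_zero_of_le hp.two_le h2
  have hψ₀ : ∀ c, ψ₀ (Ideal.Quotient.mk I c) = c ^ p := fun c => rfl
  let ψ : A →+* B := ψ₀.comp g.toRingHom
  choose y hy using fun i => Ideal.Quotient.mk_surjective (g (x i))
  have hψ : ∀ a c, g a = Ideal.Quotient.mk I c → ψ a = c ^ p := fun a c h => by
    change ψ₀ (g a) = _
    rw [h, hψ₀]
  let : Algebra A B := ψ.toAlgebra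
  have hsmul : ∀ (a : A) (c : B), a • c = ψ a * c := fun _ _ => rfl
  -- A lift sending $x_i$ to $y_i$ must send $a^p m$ to $\psi(a)$ times the image of $m$, so it is
  -- linear over `A` acting through `ψ` and is determined on the $p$-basis.
  let G : Twist φ →ₗ[A] B := b.constr A fun a => ∏ i, y i ^ (a i : ℕ)
  -- Dividing each exponent by $p$ with remainder extends the formula to all monomials;
  -- multiplicativity of `G` follows.
  have hG : ∀ m : ι → ℕ, G (of φ (∏ i, x i ^ m i)) = ∏ i, y i ^ m i := by
    intro m
    have h1 : of φ (∏ i, x i ^ m i) =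
        (∏ i, x i ^ (m i / p)) • b fun i => ⟨m i % p, Nat.mod_lt _ hp.pos⟩ := by
      rw [hb, smul_of, hφ, ← Finset.prod_pow, ← Finset.prod_mul_distrib]
      congr 1
      refine Finset.prod_congr rfl fun i _ => ?_
      rw [← pow_mul, ← pow_add, Nat.div_add_mod']
    rw [h1, map_smul, Module.Basis.constr_basis, hsmul, map_prod, ← Finset.prod_mul_distrib]
    refine Finset.prod_congr rfl fun i _ => ?_
    rw [map_pow, hψ (x i) (y i) (hy i).symm, ← pow_mul, ← pow_add]
    simp only [Nat.div_add_mod]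
  have hG1 : G 1 = 1 := by
    have := hG 0
    simpa using this
  have hGmul : ∀ u v, G (u * v) = G u * G v := by
    have : (LinearMap.mul A (Twist φ)).compr₂ G = (LinearMap.mul A B).compl₁₂ G G := by
      refine b.ext fun s => b.ext fun t => ?_
      change G (b s * b t) = G (b s) * G (b t)
      rw [hb, hb, hG, hG, ← map_mul, ← Finset.prod_mul_distrib, ← Finset.prod_mul_distrib]
      simp only [← pow_add]
      exact hG fun i => (s i : ℕ) + t i
    exact fun u v => congr($this u v)
  have hGpow : ∀ c, G (of φ (c ^ p)) = ψ c := fun c => by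
    have : of φ (c ^ p) = c • (1 : Twist φ) := by
      rw [← map_one (of φ), smul_of, hφ, mul_one]
    rw [this, map_smul, hG1, hsmul, mul_one]
  let F : A →ₐ[k] B :=
    { toFun := fun a => G (of φ a)
      map_one' := hG1
      map_mul' := fun u v => hGmul _ _
      map_zero' := map_zero G
      map_add' := fun u v => map_add G _ _
      commutes' := fun c => by
        obtain ⟨d, rfl⟩ := hk c
        rw [map_pow (algebraMap k A), map_pow (algebraMap k B), hGpow]
        exact hψ _ _ (g.commutes d) }
  refine ⟨F, AlgHom.ext fun a => ?_⟩
  change Ideal.Quotient.mk I (G (of φ a)) = g ((of φ).symm (of φ a))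
  generalize of φ a = w
  have hw : w ∈ Submodule.span A (Set.range b) := by rw [b.span_eq]; trivial
  induction hw using Submodule.span_induction with
  | mem w hw =>
    obtain ⟨s, rfl⟩ := hw
    rw [hb, hG]
    simp [hy]
  | zero => simp
  | add u v _ _ hu hv => simp [hu, hv]
  | smul c u _ hu =>
    obtain ⟨u, rfl⟩ := (of φ).surjective u
    obtain ⟨d, hd⟩ := Ideal.Quotient.mk_surjective (g c)
    rw [map_smul, hsmul, map_mul, hu, hψ c d hd.symm, map_pow, hd, smul_of, hφ]
    simp

end PBasis

/-! ### Lech independence -/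

section Lech

variable {A ι : Type*} [CommRing A] [Fintype ι]

/-- A finite family is independent in the sense of Lech if the coefficients of every linear
relation between its members lie in the ideal that it generates. -/
def LechIndependent (f : ι → A) : Prop :=
  ∀ c : ι → A, ∑ i, c i * f i = 0 → ∀ i, c i ∈ Ideal.span (Set.range f)

variable [DecidableEq ι]

omit [Fintype ι] in
theorem span_range_le_span_range_update {f : ι → A} {j : ι} {g h : A} (hj : f j = g * h) :
    Ideal.span (Set.range f) ≤ Ideal.span (Set.range (Function.update f j g)) := by
  rw [Ideal.span_le]
  rintro _ ⟨i, rfl⟩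
  by_cases hi : i = j
  · subst hi
    rw [hj]
    exact Ideal.mul_mem_right _ _ (Ideal.subset_span ⟨i, by simp⟩)
  · exact Ideal.subset_span ⟨i, by simp [hi]⟩

/-- Multiplying $ha=\sum c_if_i$ by $g$ gives a relation among the $f_i$ in which $f_j$ has
coefficient $a-c_jg$. -/
theorem LechIndependent.mem_of_mul_mem {f : ι → A} (hf : LechIndependent f) {j : ι} {g h a : A}
    (hj : f j = g * h) (ha : h * a ∈ Ideal.span (Set.range f)) :
    a ∈ Ideal.span (Set.range (Function.update f j g)) := by
  obtain ⟨c, hc⟩ := (Ideal.mem_span_range_iff_exists_fun).1 ha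
  have key : ∑ i, (if i = j then a - c j * g else -(g * c i)) * f i = 0 := by
    rw [← Finset.add_sum_erase _ _ (Finset.mem_univ j)] at hc ⊢
    have : ∑ i ∈ Finset.univ.erase j, (if i = j then a - c j * g else -(g * c i)) * f i =
        -g * ∑ i ∈ Finset.univ.erase j, c i * f i := by
      rw [Finset.mul_sum]
      refine Finset.sum_congr rfl fun i hi => ?_
      rw [if_neg (Finset.ne_of_mem_erase hi)]
      ring
    rw [this, if_pos rfl, hj]
    rw [hj] at hc
    linear_combination -g * hc
  have h1 := hf _ key j
  rw [if_pos rfl] at h1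
  have h2 := span_range_le_span_range_update hj h1
  have h3 : g ∈ Ideal.span (Set.range (Function.update f j g)) := Ideal.subset_span ⟨j, by simp⟩
  simpa using Ideal.add_mem _ h2 (Ideal.mul_mem_left _ (c j) h3)

/-- Multiplying a relation for the new family by $h$ puts $a_j$ in the old ideal. Substituting
$a_j=\sum b_if_i$ back yields a relation among the $f_i$ with coefficients $a_i+b_ig$ for $i\ne j$.
-/
theorem LechIndependent.update {f : ι → A} (hf : LechIndependent f) {j : ι} {g h : A}
    (hj : f j = g * h) : LechIndependent (Function.update f j g) := by
  intro a ha
  have hle := span_range_le_span_range_update hj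
  have hg : g ∈ Ideal.span (Set.range (Function.update f j g)) := Ideal.subset_span ⟨j, by simp⟩
  have ha' : a j * g + ∑ i ∈ Finset.univ.erase j, a i * f i = 0 := by
    rw [← ha, ← Finset.add_sum_erase _ _ (Finset.mem_univ j), Function.update_self]
    congr 1
    refine Finset.sum_congr rfl fun i hi => ?_
    rw [Function.update_of_ne (Finset.ne_of_mem_erase hi)]
  have h1 : a j ∈ Ideal.span (Set.range f) := by
    have key : ∑ i, (if i = j then a j else h * a i) * f i = 0 := by
      rw [← Finset.add_sum_erase _ _ (Finset.mem_univ j)]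
      have : ∑ i ∈ Finset.univ.erase j, (if i = j then a j else h * a i) * f i =
          h * ∑ i ∈ Finset.univ.erase j, a i * f i := by
        rw [Finset.mul_sum]
        refine Finset.sum_congr rfl fun i hi => ?_
        rw [if_neg (Finset.ne_of_mem_erase hi)]
        ring
      rw [this, if_pos rfl, hj]
      linear_combination h * ha'
    simpa using hf _ key j
  intro i
  by_cases hi : i = j
  · subst hi
    exact hle h1
  obtain ⟨b, hb⟩ := (Ideal.mem_span_range_iff_exists_fun).1 h1
  have key : ∑ i, (if i = j then b j * g else a i + b i * g) * f i = 0 := by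
    rw [← Finset.add_sum_erase _ _ (Finset.mem_univ j)] at hb ⊢
    have : ∑ i ∈ Finset.univ.erase j, (if i = j then b j * g else a i + b i * g) * f i =
        ∑ i ∈ Finset.univ.erase j, a i * f i + g * ∑ i ∈ Finset.univ.erase j, b i * f i := by
      rw [Finset.mul_sum, ← Finset.sum_add_distrib]
      refine Finset.sum_congr rfl fun i hi => ?_
      rw [if_neg (Finset.ne_of_mem_erase hi)]
      ring
    rw [this, if_pos rfl]
    linear_combination ha' + g * hb
  have h2 := hf _ key i
  rw [if_neg hi] at h2
  simpa using Ideal.sub_mem _ (hle h2) (Ideal.mul_mem_left _ (b i) hg)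

/-- If the powers `x i ^ (e i + 1)` are independent in the sense of Lech, then the monomial
`∏ i, x i ^ e i` lies outside the ideal which they generate. -/
theorem LechIndependent.prod_pow_notMem {x : ι → A} (hx : Ideal.span (Set.range x) ≠ ⊤) (n : ℕ) :
    ∀ e : ι → ℕ, ∑ i, e i = n → LechIndependent (fun i => x i ^ (e i + 1)) →
      ∏ i, x i ^ e i ∉ Ideal.span (Set.range fun i => x i ^ (e i + 1)) := by
  induction n with
  | zero =>
    intro e he _ hmem
    have he0 : ∀ i, e i = 0 := by simpa using he
    simp only [he0, zero_add, pow_one, pow_zero, Finset.prod_const_one] at hmem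
    exact hx ((Ideal.eq_top_iff_one _).2 hmem)
  | succ n ih =>
    intro e he hind hmem
    obtain ⟨j, hj⟩ : ∃ j, e j ≠ 0 := by
      by_contra! h
      simp [h] at he
    obtain ⟨m, hm⟩ := Nat.exists_eq_succ_of_ne_zero hj
    have hsplit : (fun i => x i ^ (e i + 1)) j = x j ^ (m + 1) * x j := by
      simp only [hm, Nat.succ_eq_add_one, pow_succ]
    have hupd : Function.update (fun i => x i ^ (e i + 1)) j (x j ^ (m + 1)) =
        fun i => x i ^ (Function.update e j m i + 1) := by
      ext i
      by_cases hi : i = j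
      · subst hi; simp
      · simp [hi]
    have hprod : ∏ i, x i ^ e i = x j * ∏ i, x i ^ Function.update e j m i := by
      rw [← Finset.mul_prod_erase _ _ (Finset.mem_univ j),
        ← Finset.mul_prod_erase _ (fun i => x i ^ Function.update e j m i) (Finset.mem_univ j),
        Function.update_self, hm, pow_succ', mul_assoc]
      congr 2
      refine Finset.prod_congr rfl fun i hi => ?_
      rw [Function.update_of_ne (Finset.ne_of_mem_erase hi)]
    have h1 := hind.update hsplit
    rw [hprod] at hmem
    have h2 := hind.mem_of_mul_mem hsplit hmem
    rw [hupd] at h1 h2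
    refine ih _ ?_ h1 h2
    rw [← Finset.add_sum_erase _ _ (Finset.mem_univ j), hm] at he
    rw [← Finset.add_sum_erase _ _ (Finset.mem_univ j), Function.update_self]
    have : ∑ i ∈ Finset.univ.erase j, Function.update e j m i =
        ∑ i ∈ Finset.univ.erase j, e i := Finset.sum_congr rfl fun i hi => by
      rw [Function.update_of_ne (Finset.ne_of_mem_erase hi)]
    omega

end Lech

/-! ### A $p$-basis for a local ring with finite free Frobenius -/

section Kunz

open Twist IsLocalRing

variable {A : Type*} [CommRing A]

/-- In a generating set of least cardinality, a relation with a unit coefficient would make one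
generator redundant. -/
theorem exists_minimal_generators [IsLocalRing A] [IsNoetherianRing A] :
    ∃ s : Finset A, Ideal.span (Set.range fun i : s => (i : A)) = maximalIdeal A ∧
      ∀ c : s → A, ∑ i, c i * (i : A) = 0 → ∀ i, c i ∈ maximalIdeal A := by
  classical
  have hex : ∃ n, ∃ s : Finset A, s.card = n ∧ Ideal.span (s : Set A) = maximalIdeal A := by
    obtain ⟨s, hs⟩ := IsNoetherian.noetherian (maximalIdeal A)
    exact ⟨_, s, rfl, hs⟩
  obtain ⟨s, hs, hspan⟩ := Nat.find_spec hex
  refine ⟨s, by simpa using hspan, fun c hc i => ?_⟩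
  by_contra hi
  have hu : IsUnit (c i) := by simpa using hi
  have hmem : (i : A) ∈ Ideal.span ((s.erase i : Finset A) : Set A) := by
    rw [← Finset.add_sum_erase _ _ (Finset.mem_univ i)] at hc
    have h1 : c i * (i : A) ∈ Ideal.span ((s.erase i : Finset A) : Set A) := by
      rw [eq_neg_of_add_eq_zero_left hc]
      refine neg_mem (Ideal.sum_mem _ fun j hj => Ideal.mul_mem_left _ _ (Ideal.subset_span ?_))
      have : (j : A) ≠ i := fun h => Finset.ne_of_mem_erase hj (Subtype.ext h)
      simp [this]
    exact (Ideal.unit_mul_mem_iff_mem _ hu).1 h1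
  have hspan' : Ideal.span ((s.erase i : Finset A) : Set A) = maximalIdeal A := by
    rw [← hspan]
    refine le_antisymm (Ideal.span_mono (by simp)) (Ideal.span_le.2 fun a ha => ?_)
    by_cases h : a = i
    · rw [h]; exact hmem
    · exact Ideal.subset_span (by simpa [h] using ha)
  have := Nat.find_min' hex ⟨_, rfl, hspan'⟩
  rw [Finset.card_erase_of_mem i.2, ← hs] at this
  have := Finset.card_pos.2 ⟨_, i.2⟩
  omega

variable {ι : Type*} [Fintype ι] {p : ℕ} {φ : A →+* A} {x : ι → A}

omit [Fintype ι] in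
theorem pow_mem_span_pow (hφ : ∀ a, φ a = a ^ p) {a : A} (ha : a ∈ Ideal.span (Set.range x)) :
    a ^ p ∈ Ideal.span (Set.range fun i => x i ^ p) := by
  have h := Ideal.mem_map_of_mem φ ha
  rw [Ideal.map_span, ← Set.range_comp, hφ] at h
  convert! h using 3
  ext i
  exact (hφ _).symm

/-- In the twist, $\sum c_ix_i^p=0$ reads $\sum x_i\cdot c_i=0$. Each coordinate in a basis is then
a relation among the $x_i$, so the coordinates of $c_i$ lie in $(x)$ and $c_i$ lies in the ideal
generated by their $p$-th powers. -/
theorem lechIndependent_pow (hφ : ∀ a, φ a = a ^ p) [Module.Free A (Twist φ)]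
    (hx : ∀ c : ι → A, ∑ i, c i * x i = 0 → ∀ i, c i ∈ Ideal.span (Set.range x)) :
    LechIndependent fun i => x i ^ p := by
  intro c hc i
  let b := Module.Free.chooseBasis A (Twist φ)
  have h0 : ∑ i, x i • of φ (c i) = 0 := by
    simp only [smul_of, hφ]
    rw [← map_sum, ← map_zero (of φ), ← hc]
    simp only [mul_comm]
  have h1 : ∀ j, b.repr (of φ (c i)) j ∈ Ideal.span (Set.range x) := fun j =>
    hx (fun i => b.repr (of φ (c i)) j) (by
      have := congr(b.repr $h0 j)
      simpa [mul_comm] using this) i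
  have h2 := b.linearCombination_repr (of φ (c i))
  rw [Finsupp.linearCombination_apply, Finsupp.sum] at h2
  have h3 : c i = ∑ j ∈ (b.repr (of φ (c i))).support,
      (b.repr (of φ (c i)) j) ^ p * (of φ).symm (b j) := by
    apply (of φ).injective
    rw [map_sum]
    refine h2.symm.trans (Finset.sum_congr rfl fun j _ => ?_)
    rw [← hφ, ← smul_of]
    rfl
  rw [h3]
  exact Ideal.sum_mem _ fun j _ => Ideal.mul_mem_right _ _ (pow_mem_span_pow hφ (h1 j))

/-- Among the exponents with unit coefficient take `a` of least total degree and multiply by $\prod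
x_i^{p-1-a_i}$. All other terms fall into $(x_i^p)$, leaving a unit times $\prod x_i^{p-1}$, which
Lech's lemma excludes. -/
theorem mem_maximalIdeal_of_sum_monomials_mem [DecidableEq ι] [IsLocalRing A] (hp : p.Prime)
    (hφ : ∀ a, φ a = a ^ p) (hspan : Ideal.span (Set.range x) = maximalIdeal A)
    (hind : LechIndependent fun i => x i ^ p) (c : (ι → Fin p) → A)
    (hc : ∑ a, c a ^ p * ∏ i, x i ^ (a i : ℕ) ∈ Ideal.span (Set.range fun i => x i ^ p))
    (a : ι → Fin p) : c a ∈ maximalIdeal A := by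
  classical
  set J := Ideal.span (Set.range fun i => x i ^ p) with hJ
  have hxp : ∀ i, x i ^ p ∈ J := fun i => Ideal.subset_span ⟨i, rfl⟩
  by_contra ha
  obtain ⟨a, ha, hmin⟩ := Finset.exists_min_image
    (Finset.univ.filter fun a => c a ∉ maximalIdeal A) (fun a => ∑ i, (a i : ℕ)) ⟨a, by simpa using ha⟩
  have hca : c a ∉ maximalIdeal A := by simpa using ha
  have h1 := Ideal.mul_mem_right (∏ i, x i ^ (p - 1 - (a i : ℕ))) J hc
  rw [Finset.sum_mul, ← Finset.add_sum_erase _ _ (Finset.mem_univ a)] at h1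
  have h2 : ∑ a' ∈ Finset.univ.erase a, (c a' ^ p * ∏ i, x i ^ (a' i : ℕ)) *
      ∏ i, x i ^ (p - 1 - (a i : ℕ)) ∈ J := by
    refine Ideal.sum_mem _ fun a' ha' => ?_
    by_cases hca' : c a' ∈ maximalIdeal A
    · rw [← hspan] at hca'
      exact Ideal.mul_mem_right _ _ (Ideal.mul_mem_right _ _ (pow_mem_span_pow hφ hca'))
    obtain ⟨j, hj⟩ : ∃ j, a j < a' j := by
      by_contra! h
      have h3 := hmin a' (by simpa using hca')
      have h4 : ∀ i ∈ Finset.univ, (a' i : ℕ) = a i :=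
        (Finset.sum_eq_sum_iff_of_le (f := fun i => (a' i : ℕ)) (g := fun i => (a i : ℕ))
          fun i _ => h i).1
          (le_antisymm (Finset.sum_le_sum fun i _ => h i) h3)
      exact Finset.ne_of_mem_erase ha' (funext fun i => Fin.ext (h4 i (Finset.mem_univ i)))
    rw [mul_assoc, ← Finset.prod_mul_distrib, ← Finset.mul_prod_erase _ _ (Finset.mem_univ j)]
    refine Ideal.mul_mem_left _ _ (Ideal.mul_mem_right _ _ ?_)
    have hj' : (a j : ℕ) < a' j := hj
    have := (a j).2
    have := (a' j).2
    rw [← pow_add, show (a' j : ℕ) + (p - 1 - a j) = p + (a' j - a j - 1) by omega, pow_add]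
    exact Ideal.mul_mem_right _ _ (hxp j)
  have h3 := (Submodule.add_mem_iff_left J h2).1 h1
  rw [mul_assoc, ← Finset.prod_mul_distrib] at h3
  have hu : IsUnit (c a) := by simpa using hca
  rw [Ideal.unit_mul_mem_iff_mem _ (hu.pow p)] at h3
  have hp1 : p - 1 + 1 = p := Nat.sub_add_cancel hp.one_le
  have h4 : ∀ i, x i ^ (a i : ℕ) * x i ^ (p - 1 - (a i : ℕ)) = x i ^ (p - 1) := fun i => by
    have := (a i).2
    rw [← pow_add]
    congr 1
    omega
  simp only [h4] at h3
  refine LechIndependent.prod_pow_notMem (x := x) ?_ _ (fun _ => p - 1) rfl ?_ ?_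
  · rw [hspan]; exact Ideal.IsPrime.ne_top inferInstance
  · simpa only [hp1] using hind
  · simpa only [hp1] using h3

/-- Modulo the maximal ideal acting on the twist, that is modulo $(x_i^p)$, the span is stable under
multiplication by the $x_i$ and contains the constants, as these are $p$-th powers. Successive
approximation reaches every element modulo $\mathfrak{m}^n\subseteq(x_i^p)$, and Nakayama concludes.
-/
theorem span_monomials_eq_top {k : Type*} [Field k] [Algebra k A] [IsLocalRing A]
    [IsNoetherianRing A] (hp : p.Prime) (hk : ∀ c : k, ∃ d, d ^ p = c)
    (hres : ∀ a : A, ∃ c : k, a - algebraMap k A c ∈ maximalIdeal A)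
    (hφ : ∀ a, φ a = a ^ p) (hspan : Ideal.span (Set.range x) = maximalIdeal A)
    [Module.Finite A (Twist φ)] :
    Submodule.span A (Set.range fun a : ι → Fin p => of φ (∏ i, x i ^ (a i : ℕ))) = ⊤ := by
  classical
  set N := Submodule.span A (Set.range fun a : ι → Fin p => of φ (∏ i, x i ^ (a i : ℕ))) with hN
  set T := N ⊔ maximalIdeal A • (⊤ : Submodule A (Twist φ)) with hT
  have hxm : ∀ i, x i ∈ maximalIdeal A := fun i => hspan ▸ Ideal.subset_span ⟨i, rfl⟩
  have hxT : ∀ i b, of φ (x i ^ p * b) ∈ maximalIdeal A • (⊤ : Submodule A (Twist φ)) :=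
    fun i b => by
      rw [← hφ, ← smul_of]
      exact Submodule.smul_mem_smul (hxm i) trivial
  have hmul : ∀ i, ∀ t ∈ T, of φ (x i) * t ∈ T := by
    intro i t ht
    obtain ⟨n, hn, m, hm, rfl⟩ := Submodule.mem_sup.1 ht
    rw [mul_add]
    refine add_mem ?_ (Submodule.mem_sup_right ?_)
    · clear ht
      induction hn using Submodule.span_induction with
      | mem n hn =>
        obtain ⟨a, rfl⟩ := hn
        rw [← map_mul, ← Finset.mul_prod_erase _ _ (Finset.mem_univ i), ← mul_assoc, ← pow_succ']
        by_cases hai : (a i : ℕ) + 1 = p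
        · rw [hai]
          exact Submodule.mem_sup_right (hxT _ _)
        · refine Submodule.mem_sup_left (Submodule.subset_span
            ⟨Function.update a i ⟨a i + 1, by have := (a i).2; omega⟩, ?_⟩)
          dsimp only
          rw [← Finset.mul_prod_erase _ _ (Finset.mem_univ i), Function.update_self]
          congr 2
          refine Finset.prod_congr rfl fun j hj => ?_
          rw [Function.update_of_ne (Finset.ne_of_mem_erase hj)]
      | zero => simp
      | add u v _ _ hu hv =>
        rw [mul_add]
        exact add_mem hu hv
      | smul c u hu' hu =>
        rw [mul_smul_comm]
        exact Submodule.smul_mem _ _ hu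
    · refine Submodule.smul_induction_on hm (fun r hr u _ => ?_) (fun u v hu hv => ?_)
      · rw [mul_smul_comm]
        exact Submodule.smul_mem_smul hr trivial
      · rw [mul_add]
        exact add_mem hu hv
  have hone : (1 : Twist φ) ∈ T :=
    Submodule.mem_sup_left (Submodule.subset_span ⟨fun _ => ⟨0, hp.pos⟩, by simp⟩)
  have hconst : ∀ c : k, of φ (algebraMap k A c) ∈ T := fun c => by
    obtain ⟨d, rfl⟩ := hk c
    have : of φ (algebraMap k A (d ^ p)) = algebraMap k A d • (1 : Twist φ) := by
      rw [← map_one (of φ), smul_of, hφ, mul_one, map_pow (algebraMap k A)]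
    rw [this]
    exact Submodule.smul_mem _ _ hone
  have happrox : ∀ n (a : A), ∃ t : A, of φ t ∈ T ∧ a - t ∈ maximalIdeal A ^ n := by
    intro n
    induction n with
    | zero => exact fun a => ⟨0, by simp, by simp⟩
    | succ n ih =>
      intro a
      obtain ⟨c, hc⟩ := hres a
      rw [← hspan] at hc
      obtain ⟨y, hy⟩ := (Ideal.mem_span_range_iff_exists_fun).1 hc
      choose t ht ht' using fun i => ih (y i)
      refine ⟨algebraMap k A c + ∑ i, x i * t i, ?_, ?_⟩
      · rw [map_add, map_sum]
        refine add_mem (hconst c) (sum_mem fun i _ => ?_)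
        rw [map_mul]
        exact hmul i _ (ht i)
      · have : a - (algebraMap k A c + ∑ i, x i * t i) = ∑ i, (y i - t i) * x i := by
          simp only [sub_mul, Finset.sum_sub_distrib, hy, mul_comm (x _)]
          ring
        rw [this, pow_succ]
        exact Ideal.sum_mem _ fun i _ => Ideal.mul_mem_mul (ht' i) (hxm i)
  have hJT : ∀ b ∈ Ideal.span (Set.range fun i => x i ^ p), of φ b ∈ T := by
    intro b hb
    obtain ⟨c, rfl⟩ := (Ideal.mem_span_range_iff_exists_fun).1 hb
    rw [map_sum]
    refine sum_mem fun i _ => Submodule.mem_sup_right ?_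
    rw [mul_comm]
    exact hxT _ _
  have htop : T = ⊤ := by
    rw [eq_top_iff]
    intro w _
    obtain ⟨a, rfl⟩ := (of φ).surjective w
    have hrad : maximalIdeal A ≤ (Ideal.span (Set.range fun i => x i ^ p)).radical := by
      rw [← hspan, Ideal.span_le]
      rintro _ ⟨i, rfl⟩
      exact ⟨p, Ideal.subset_span ⟨i, rfl⟩⟩
    obtain ⟨n, hn⟩ := Ideal.exists_pow_le_of_le_radical_of_fg hrad (IsNoetherian.noetherian _)
    obtain ⟨t, ht, ht'⟩ := happrox n a
    have := add_mem (hJT _ (hn ht')) ht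
    rwa [← map_add, sub_add_cancel] at this
  rw [eq_top_iff]
  exact Submodule.le_of_le_smul_of_le_jacobson_bot Module.Finite.fg_top
    (maximalIdeal_le_jacobson _) htop.ge

/-- A minimal system of generators of the maximal ideal of a Noetherian local ring with finite flat
Frobenius is a `p`-basis, if the residue field is the perfect field `k`. -/
theorem exists_pBasis {k : Type*} [Field k] [Algebra k A] [IsLocalRing A]
    [IsNoetherianRing A] (hp : p.Prime) (hk : ∀ c : k, ∃ d, d ^ p = c)
    (hres : ∀ a : A, ∃ c : k, a - algebraMap k A c ∈ maximalIdeal A)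
    (hφ : ∀ a, φ a = a ^ p) [Module.Finite A (Twist φ)] [Module.Free A (Twist φ)] :
    ∃ (s : Finset A) (b : Module.Basis (s → Fin p) A (Twist φ)),
      ∀ a, b a = of φ (∏ i : s, (i : A) ^ (a i : ℕ)) := by
  classical
  obtain ⟨s, hs, hmin⟩ := exists_minimal_generators (A := A)
  have hspan := span_monomials_eq_top (φ := φ) hp hk hres hφ hs
  have hind := lechIndependent_pow (φ := φ) hφ (x := fun i : s => (i : A)) (by rwa [hs])
  have hli : LinearIndependent A fun a : s → Fin p => of φ (∏ i : s, (i : A) ^ (a i : ℕ)) := by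
    -- By flatness it is enough to test independence over the residue field, where a relation says
    -- that $\sum d_a^p x^a$ lies in $(x_i^p)$.
    apply Module.IsLocalRing.linearIndependent_of_flat
    rw [Fintype.linearIndependent_iff]
    intro c hc a
    choose d hd using fun a => residue_surjective (c a)
    have h1 : TensorProduct.mk A (ResidueField A) (Twist φ) 1
        (∑ a, d a • of φ (∏ i : s, (i : A) ^ (a i : ℕ))) = 0 := by
      rw [← hc, map_sum]
      refine Finset.sum_congr rfl fun a _ => ?_
      rw [map_smul, ← hd a, Function.comp_apply]
      rfl
    have h2 : ∀ w ∈ maximalIdeal A • (⊤ : Submodule A (Twist φ)),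
        (of φ).symm w ∈ Ideal.span (Set.range fun i : s => (i : A) ^ p) := by
      intro w hw
      refine Submodule.smul_induction_on hw (fun r hr u _ => ?_) (fun u v hu hv => ?_)
      · obtain ⟨u, rfl⟩ := (of φ).surjective u
        rw [smul_of, hφ, RingEquiv.symm_apply_apply]
        exact Ideal.mul_mem_right _ _ (pow_mem_span_pow hφ (by rwa [hs]))
      · rw [map_add]
        exact add_mem hu hv
    have h3 := h2 _ ((LinearMap.ker_tensorProductMk (Q := Twist φ) (I := maximalIdeal A)).le h1)
    simp only [smul_of, hφ, map_sum, RingEquiv.symm_apply_apply] at h3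
    rw [← hd a, residue_eq_zero_iff]
    exact mem_maximalIdeal_of_sum_monomials_mem hp hφ hs hind d h3 a
  exact ⟨s, Module.Basis.mk hli hspan.ge, fun a => by simp⟩

end Kunz

/-! ### Kunz's theorem over an algebraically closed field -/

section Smooth

open Twist

/-- Kunz's theorem for algebras of finite type over an algebraically closed field: if the Frobenius
makes `R` a finite free `R`-module then `R` is smooth. -/
theorem smooth_of_free_twist {k R : Type u} [Field k] [IsAlgClosed k] [CommRing R] [Algebra k R]
    [Algebra.FiniteType k R] {p : ℕ} (hp : p.Prime) [CharP k p] (φ : R →+* R)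
    (hφ : ∀ a, φ a = a ^ p) [Module.Finite R (Twist φ)] [Module.Free R (Twist φ)] :
    Algebra.Smooth k R := by
  have : IsNoetherianRing R := Algebra.FiniteType.isNoetherianRing k R
  have : Algebra.FinitePresentation k R := Algebra.FinitePresentation.of_finiteType.1 inferInstance
  have hk : ∀ c : k, ∃ d, d ^ p = c := fun c => IsAlgClosed.exists_pow_nat_eq c hp.pos
  refine ⟨Algebra.smoothLocus_eq_univ_iff.1 ?_, inferInstance⟩
  have hmax : ∀ m : PrimeSpectrum R, m.asIdeal.IsMaximal → m ∈ Algebra.smoothLocus k R := by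
    intro m hm
    let Rm := Localization.AtPrime m.asIdeal
    have hpm : (p : Rm) = 0 := by
      rw [← map_natCast (algebraMap k Rm), CharP.cast_eq_zero, map_zero]
    let ψ := powRingHom Rm p hp hpm
    have hψ : ∀ a, ψ a = a ^ p := fun a => rfl
    obtain ⟨_, _⟩ := Twist.finite_free_of_isLocalization m.asIdeal.primeCompl hp.ne_zero φ ψ hφ hψ
    have : IsNoetherianRing Rm := IsLocalization.isNoetherianRing m.asIdeal.primeCompl Rm inferInstance
    -- By the Nullstellensatz the residue field at a maximal ideal is `k`.
    have hres : ∀ a : Rm, ∃ c : k, a - algebraMap k Rm c ∈ IsLocalRing.maximalIdeal Rm := by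
      intro a
      let := Ideal.Quotient.field m.asIdeal
      have : Module.Finite k (R ⧸ m.asIdeal) := finite_of_finite_type_of_isJacobsonRing _ _
      have hbij := IsAlgClosed.algebraMap_bijective_of_isIntegral (k := k) (K := R ⧸ m.asIdeal)
      obtain ⟨c, hc⟩ : ∃ c : R, a - algebraMap R Rm c ∈ IsLocalRing.maximalIdeal Rm := by
        obtain ⟨c, hc⟩ := (IsLocalization.AtPrime.equivQuotMaximalIdeal m.asIdeal Rm).surjective
          (Ideal.Quotient.mk _ a)
        obtain ⟨c, rfl⟩ := Ideal.Quotient.mk_surjective c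
        exact ⟨c, Ideal.Quotient.eq.1 (by rw [← hc]; rfl)⟩
      obtain ⟨d, hd⟩ := hbij.2 (Ideal.Quotient.mk _ c)
      refine ⟨d, ?_⟩
      have h1 : c - algebraMap k R d ∈ m.asIdeal := Ideal.Quotient.eq.1 hd.symm
      have h2 : algebraMap R Rm (c - algebraMap k R d) ∈ IsLocalRing.maximalIdeal Rm := by
        rw [← IsLocalization.AtPrime.map_eq_maximalIdeal m.asIdeal Rm]
        exact Ideal.mem_map_of_mem _ h1
      rw [map_sub, ← IsScalarTower.algebraMap_apply] at h2
      simpa using add_mem hc h2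
    obtain ⟨s, b, hb⟩ := exists_pBasis (φ := ψ) hp hk hres hψ
    exact formallySmooth_of_pBasis hp hk ψ hψ _ b hb
  -- Every prime specializes to a maximal one, and the smooth locus is open, hence stable under
  -- generization.
  by_contra hne
  obtain ⟨q, hq⟩ := (Set.ne_univ_iff_exists_notMem _).1 hne
  obtain ⟨m, hm, hqm⟩ := q.asIdeal.exists_le_maximal q.2.ne_top
  refine hq ?_
  have hmem := hmax ⟨m, hm.isPrime⟩ hm
  exact (PrimeSpectrum.le_iff_specializes q ⟨m, hm.isPrime⟩).1 hqm |>.mem_open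
    Algebra.isOpen_smoothLocus hmem

end Smooth

/-! ### Invertible summands of $F_*\mathcal{O}_X$ as operators on sections -/

section Sections

variable {X : Scheme.{u}} {p : ℕ} (hp : p.Prime) (hX : IsOfChar X p)

/-- The module `F_* 𝒪_X`. -/
noncomputable abbrev frobeniusModule : X.Modules :=
  (Scheme.Modules.pushforward (absFrobenius X p hp hX)).obj (structureModule X)

/-- A section of `𝒪_X` as a section of `F_* 𝒪_X`. -/
noncomputable def toFrob (V : X.Opens) : Γ(X, V) ≃+ Γ(frobeniusModule hp hX, V) :=
  AddEquiv.refl Γ(X, V)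

theorem map_toFrob {V W : X.Opens} (i : W ⟶ V) (t : Γ(X, V)) :
    (frobeniusModule hp hX).presheaf.map i.op (toFrob hp hX V t) =
      toFrob hp hX W (X.presheaf.map i.op t) := rfl

theorem sharp_app_eq (V : X.Opens) (t : Γ(X, V)) :
    (sharp (absFrobenius X p hp hX)).app V t = toFrob hp hX V (t ^ p) := rfl

theorem naturality_app {M N : X.Modules} (φ : M ⟶ N) {V W : X.Opens} (i : W ⟶ V) (t : Γ(M, V)) :
    φ.app W (M.presheaf.map i.op t) = N.presheaf.map i.op (φ.app V t) :=
  congr($(φ.mapPresheaf.naturality i.op) t)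

/-- A local generator of an invertible sheaf. -/
theorem IsInvertible.exists_generator {L : X.Modules} (hL : IsInvertible L) (x : X) :
    ∃ (U : X.Opens) (_ : x ∈ U) (g : Γ(L, U)), ∀ (V : X.Opens) (h : V ≤ U),
      Function.Bijective fun u : Γ(X, V) => u • L.presheaf.map (homOfLE h).op g := by
  obtain ⟨U, hxU, ⟨e⟩⟩ := hL x
  let one (W : (U : Scheme.{u}).Opens) : Γ(structureModule (U : Scheme.{u}), W) :=
    (1 : Γ((U : Scheme.{u}), W))
  let gen (W : (U : Scheme.{u}).Opens) : Γ(L, U.ι ''ᵁ W) := e.inv.app W (one W)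
  refine ⟨U.ι ''ᵁ ⊤, by simpa using hxU, gen ⊤, fun V h => ?_⟩
  obtain ⟨W, rfl⟩ : ∃ W, V = U.ι ''ᵁ W := ⟨U.ι ⁻¹ᵁ V, by
    rw [Scheme.Hom.image_preimage_eq_opensRange_inf, ← Scheme.Hom.image_top_eq_opensRange]
    exact (inf_eq_right.2 h).symm⟩
  have hgen : L.presheaf.map (homOfLE h).op (gen ⊤) = gen W := by
    have h1 := naturality_app e.inv (homOfLE (le_top : W ≤ ⊤)) (one ⊤)
    have h2 : (structureModule (U : Scheme.{u})).presheaf.map (homOfLE (le_top : W ≤ ⊤)).op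
        (one ⊤) = one W := map_one ((U : Scheme.{u}).presheaf.map _).hom
    rw [h2] at h1
    exact h1.symm
  have key : ∀ r : Γ((U : Scheme.{u}), W), (U.ι.appIso W).inv r • gen W =
      e.inv.app W (show Γ(structureModule (U : Scheme.{u}), W) from r) := by
    intro r
    have h1 := Scheme.Modules.Hom.app_smul e.inv r (one W)
    have h2 : r • one W = (show Γ(structureModule (U : Scheme.{u}), W) from r) :=
      mul_one (r : Γ((U : Scheme.{u}), W))
    rw [h2] at h1
    exact h1.symm
  have hbij : Function.Bijective (e.inv.app W) := ConcreteCategory.bijective_of_isIso _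
  have hbij' : Function.Bijective (U.ι.appIso W).hom := ConcreteCategory.bijective_of_isIso _
  rw [hgen]
  have : (fun u : Γ(X, U.ι ''ᵁ W) => u • gen W) =
      (e.inv.app W) ∘ (U.ι.appIso W).hom := by
    ext u
    have h1 := key ((U.ι.appIso W).hom u)
    rw [← CategoryTheory.comp_apply, Iso.hom_inv_id] at h1
    exact h1
  rw [this]
  exact hbij.comp hbij'

/-- The restriction of sections of the structure sheaf. -/
def res {V W : X.Opens} (h : W ≤ V) : Γ(X, V) →+* Γ(X, W) :=
  (X.presheaf.map (homOfLE h).op).hom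

theorem res_res {V W Z : X.Opens} (h : W ≤ V) (h' : Z ≤ W) (t : Γ(X, V)) :
    res h' (res h t) = res (h'.trans h) t := by
  change (X.presheaf.map _ ≫ X.presheaf.map _).hom t = _
  rw [← Functor.map_comp]
  rfl

theorem eq_of_locally_eq {V : X.Opens} (s t : Γ(X, V))
    (h : ∀ x ∈ V, ∃ (W : X.Opens) (_ : x ∈ W) (hW : W ≤ V), res hW s = res hW t) : s = t := by
  choose W hx hW hst using h
  refine X.sheaf.eq_of_locally_eq' (fun x : V => W x x.2) V (fun x => homOfLE (hW x x.2))
    (fun x hx' => ?_) s t fun x => hst x x.2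
  exact TopologicalSpace.Opens.mem_iSup.2 ⟨⟨x, hx'⟩, hx x hx'⟩

/-- The sections of a family of projections of `F_* 𝒪_X` onto invertible sheaves, as operators
on the sections of `𝒪_X`. -/
structure ProjectionData (X : Scheme.{u}) (p : ℕ) (ι : Type u) where
  /-- The projection with index `i` on the sections over `V`. -/
  proj (i : ι) (V : X.Opens) : Γ(X, V) →+ Γ(X, V)
  proj_pow_mul (i : ι) (V : X.Opens) (a t : Γ(X, V)) : proj i V (a ^ p * t) = a ^ p * proj i V t
  proj_map (i : ι) {V W : X.Opens} (h : W ≤ V) (t : Γ(X, V)) :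
    proj i W (res h t) = res h (proj i V t)
  proj_proj (i : ι) (V : X.Opens) (t : Γ(X, V)) : proj i V (proj i V t) = proj i V t
  proj_proj_of_ne {i j : ι} (h : i ≠ j) (V : X.Opens) (t : Γ(X, V)) :
    proj j V (proj i V t) = 0
  exists_generator (i : ι) (x : X) : ∃ (U : X.Opens) (_ : x ∈ U) (g : Γ(X, U)),
    ∀ (V : X.Opens) (h : V ≤ U),
      (∀ t, ∃ u, proj i V t = u ^ p * res h g) ∧
      (∀ u, u ^ p * res h g = 0 → u = 0) ∧
      proj i V (res h g) = res h g

variable {hp hX} in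
/-- The projection data of a family of invertible direct summands of `F_* 𝒪_X`. -/
noncomputable def ProjectionData.ofSummands {ι : Type u} {L : ι → X.Modules}
    (hL : ∀ i, IsInvertible (L i)) (inc : ∀ i, L i ⟶ frobeniusModule hp hX)
    (pr : ∀ i, frobeniusModule hp hX ⟶ L i) (h1 : ∀ i, inc i ≫ pr i = 𝟙 _)
    (h2 : ∀ i j, i ≠ j → inc i ≫ pr j = 0) : ProjectionData X p ι where
  proj i V := (toFrob hp hX V).symm.toAddMonoidHom.comp
    (((pr i ≫ inc i).app V).hom.comp (toFrob hp hX V).toAddMonoidHom)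
  proj_pow_mul i V a t := Scheme.Modules.Hom.app_smul (pr i ≫ inc i) a (toFrob hp hX V t)
  proj_map i V W h t := naturality_app (pr i ≫ inc i) (homOfLE h) (toFrob hp hX V t)
  proj_proj i V t := by
    have h : (pr i ≫ inc i) ≫ pr i ≫ inc i = pr i ≫ inc i := by
      rw [Category.assoc, reassoc_of% h1 i]
    exact congr((Scheme.Modules.Hom.app $h V).hom (toFrob hp hX V t))
  proj_proj_of_ne {i j} hij V t := by
    have h : (pr i ≫ inc i) ≫ pr j ≫ inc j = 0 := by
      rw [Category.assoc, reassoc_of% h2 i j hij, zero_comp, comp_zero]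
    exact congr((Scheme.Modules.Hom.app $h V).hom (toFrob hp hX V t))
  exists_generator i x := by
    obtain ⟨U, hxU, g, hg⟩ := (hL i).exists_generator x
    refine ⟨U, hxU, (toFrob hp hX U).symm ((inc i).app U g), fun V h => ?_⟩
    set g' := (L i).presheaf.map (homOfLE h).op g with hg'
    have hmap : res h ((toFrob hp hX U).symm ((inc i).app U g)) =
        (toFrob hp hX V).symm ((inc i).app V g') :=
      (naturality_app (inc i) (homOfLE h) g).symm
    have hsmul : ∀ u : Γ(X, V), u ^ p * (toFrob hp hX V).symm ((inc i).app V g') =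
        (toFrob hp hX V).symm ((inc i).app V (u • g')) := fun u =>
      (Scheme.Modules.Hom.app_smul (inc i) u g').symm
    have hid : ∀ s : Γ(L i, V), (pr i).app V ((inc i).app V s) = s := fun s =>
      congr((Scheme.Modules.Hom.app $(h1 i) V).hom s)
    rw [hmap]
    refine ⟨fun t => ?_, fun u hu => ?_, ?_⟩
    · obtain ⟨u, hu⟩ := (hg V h).2 ((pr i).app V (toFrob hp hX V t))
      have hu' : u • g' = _ := hu
      refine ⟨u, ?_⟩
      rw [hsmul, hu']
      rfl
    · rw [hsmul] at hu
      have h3 : (inc i).app V (u • g') = 0 := hu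
      have h4 : u • g' = 0 := by rw [← hid (u • g'), h3, map_zero]
      exact (hg V h).1 (h4.trans (zero_smul _ _).symm)
    · exact congr((inc i).app V $(hid g'))

end Sections

/-! ### Finiteness of Frobenius, and $p$-th roots of integral elements -/

section Algebra

open Twist

/-- The Frobenius of an algebra of finite type over a perfect field is finite. -/
theorem finite_twist {k R : Type*} [Field k] [CommRing R] [Algebra k R] [Algebra.FiniteType k R]
    {p : ℕ} (hp : p ≠ 0) (hk : ∀ c : k, ∃ d, d ^ p = c) (φ : R →+* R) (hφ : ∀ a, φ a = a ^ p) :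
    Module.Finite R (Twist φ) := by
  obtain ⟨s, hs⟩ := Algebra.FiniteType.out (R := k) (A := R)
  -- Constants are $p$-th powers, hence lie in the image of `R`, so generators over `k` also
  -- generate the twist over `R`.
  have : Algebra.FiniteType R (Twist φ) := by
    classical
    refine ⟨⟨s.image (of φ), ?_⟩⟩
    rw [eq_top_iff]
    intro w _
    obtain ⟨a, rfl⟩ := (of φ).surjective w
    have ha : a ∈ Algebra.adjoin k (s : Set R) := by rw [hs]; trivial
    induction ha using Algebra.adjoin_induction with
    | mem a ha => exact Algebra.subset_adjoin (by simpa using ha)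
    | algebraMap c =>
      obtain ⟨d, rfl⟩ := hk c
      have : of φ (algebraMap k R (d ^ p)) = algebraMap R (Twist φ) (algebraMap k R d) := by
        rw [algebraMap_eq, hφ, map_pow (algebraMap k R)]
      rw [this]
      exact Subalgebra.algebraMap_mem _ _
    | add a b _ _ ha hb => rw [map_add]; exact add_mem (ha trivial) (hb trivial)
    | mul a b _ _ ha hb => rw [map_mul]; exact mul_mem (ha trivial) (hb trivial)
  have : Algebra.IsIntegral R (Twist φ) := ⟨fun w => by
    obtain ⟨a, rfl⟩ := (of φ).surjective w
    refine IsIntegral.of_pow (n := p) (Nat.pos_of_ne_zero hp) ?_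
    rw [← map_pow, ← hφ, ← algebraMap_eq]
    exact isIntegral_algebraMap⟩
  exact Algebra.IsIntegral.finite

/-- In a reduced ring of characteristic `p` which is integral over an algebraically closed field,
every element is a `p`-th power. -/
theorem exists_pow_eq_of_isIntegral {k A : Type*} [Field k] [IsAlgClosed k] [CommRing A]
    [Algebra k A] {p : ℕ} (hp : p.Prime) (hA : ∀ a : A, IsNilpotent a → a = 0) (a : A)
    (ha : IsIntegral k a) : ∃ b, b ^ p = a := by
  classical
  open Polynomial in
  obtain ⟨q, hq, hqa⟩ := ha
  choose r hr using fun c : k => IsAlgClosed.exists_pow_nat_eq c hp.pos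
  -- Interpolating $p$-th roots at the roots of `q` makes `q` divide a power of $h^p-X$; hence
  -- $h(a)^p-a$ is nilpotent.
  let h : k[X] := Lagrange.interpolate q.roots.toFinset id r
  have hroot : ∀ c, q.IsRoot c → (h ^ p - X).IsRoot c := by
    intro c hc
    have h1 : h.eval c = r c := Lagrange.eval_interpolate_at_node (v := id) r
      Function.injective_id.injOn (by simpa [hq.ne_zero] using hc)
    simp [h1, hr]
  have hdvd : q ∣ (h ^ p - X) ^ q.roots.card := by
    conv_lhs => rw [(IsAlgClosed.splits q).eq_prod_roots_of_monic hq]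
    rw [← Multiset.prod_replicate, ← Multiset.map_const']
    exact Multiset.prod_dvd_prod_of_dvd _ _ fun c hc =>
      dvd_iff_isRoot.2 (hroot c (isRoot_of_mem_roots hc))
  have h2 : aeval a ((h ^ p - X) ^ q.roots.card) = 0 := by
    obtain ⟨g, hg⟩ := hdvd
    rw [hg, map_mul, aeval_def, hqa, zero_mul]
  refine ⟨aeval a h, ?_⟩
  rw [map_pow, map_sub, map_pow, aeval_X] at h2
  exact sub_eq_zero.1 (hA _ ⟨_, h2⟩)

end Algebra

/-! ### Local generators, reducedness and the idempotents $\mathrm{pr}_i(1)$ -/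

section Projections

open Twist

variable {X : Scheme.{u}} {p : ℕ} {ι : Type u}

/-- The `p`-th power map on the sections of the structure sheaf over `V`. -/
def frob (hp : p.Prime) (hX : IsOfChar X p) (V : X.Opens) : Γ(X, V) →+* Γ(X, V) :=
  powRingHom Γ(X, V) p hp (hX.section_eq_zero V)

namespace ProjectionData

variable (D : ProjectionData X p ι)

/-- `g` freely generates the image of the projection with index `i` over every open subset
of `U`. -/
def IsGenerator (i : ι) {U : X.Opens} (g : Γ(X, U)) : Prop :=
  ∀ (V : X.Opens) (h : V ≤ U), (∀ t, ∃ u, D.proj i V t = u ^ p * res h g) ∧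
    (∀ u, u ^ p * res h g = 0 → u = 0) ∧ D.proj i V (res h g) = res h g

variable {D}

theorem IsGenerator.res {i : ι} {U V : X.Opens} {g : Γ(X, U)} (hg : D.IsGenerator i g)
    (h : V ≤ U) : D.IsGenerator i (res h g) := by
  intro W hW
  rw [res_res]
  exact hg W _

theorem res_self {U : X.Opens} (h : U ≤ U) (g : Γ(X, U)) : FrobeniusSplitting.res h g = g :=
  congr($(X.presheaf.map_id (op U)) g)

theorem IsGenerator.exists_eq {i : ι} {U : X.Opens} {g : Γ(X, U)} (hg : D.IsGenerator i g)
    (t : Γ(X, U)) : ∃ u, D.proj i U t = u ^ p * g := by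
  simpa only [res_self] using (hg U le_rfl).1 t

theorem IsGenerator.eq_zero {i : ι} {U : X.Opens} {g : Γ(X, U)} (hg : D.IsGenerator i g)
    {u : Γ(X, U)} (h : u ^ p * g = 0) : u = 0 := by
  have := (hg U le_rfl).2.1 u
  rw [res_self] at this
  exact this h

theorem IsGenerator.proj_self {i : ι} {U : X.Opens} {g : Γ(X, U)} (hg : D.IsGenerator i g) :
    D.proj i U g = g := by
  have := (hg U le_rfl).2.2
  rwa [res_self] at this

theorem IsGenerator.proj_of_ne {i j : ι} (hij : i ≠ j) {U : X.Opens} {g : Γ(X, U)}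
    (hg : D.IsGenerator i g) : D.proj j U g = 0 := by
  rw [← hg.proj_self, D.proj_proj_of_ne hij]

theorem IsGenerator.proj_sum {U : X.Opens} (s : Finset ι) {g : ι → Γ(X, U)}
    (hg : ∀ i ∈ s, D.IsGenerator i (g i)) (c : ι → Γ(X, U)) {j : ι} (hj : j ∈ s) :
    D.proj j U (∑ i ∈ s, c i ^ p * g i) = c j ^ p * g j := by
  rw [map_sum, Finset.sum_eq_single_of_mem j hj fun i hi hij => by
    rw [D.proj_pow_mul, (hg i hi).proj_of_ne hij, mul_zero], D.proj_pow_mul, (hg j hj).proj_self]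

variable (D)

/-- Finitely many projections have generators over a common neighbourhood of a point. -/
theorem exists_common_generators (s : Finset ι) {V : X.Opens} {x : X} (hx : x ∈ V) :
    ∃ (U : X.Opens) (_ : x ∈ U) (_ : U ≤ V) (g : ι → Γ(X, U)), ∀ i ∈ s, D.IsGenerator i (g i) := by
  classical
  choose U hxU g hg using fun i => D.exists_generator i x
  refine ⟨V ⊓ s.inf U, ⟨hx, ?_⟩, inf_le_left, fun i => if h : i ∈ s then
    FrobeniusSplitting.res (inf_le_right.trans (Finset.inf_le h)) (g i) else 0, fun i hi => ?_⟩
  · rw [TopologicalSpace.Opens.coe_finset_inf]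
    simp [hxU]
  · dsimp only
    rw [dif_pos hi]
    exact IsGenerator.res (D := D) (hg i) _

/-- Variant of `exists_common_generators` with a basic open subset of an affine open subset. -/
theorem exists_common_generators_basicOpen (s : Finset ι) {V : X.Opens} (hV : IsAffineOpen V)
    {x : X} (hx : x ∈ V) : ∃ (r : Γ(X, V)) (_ : x ∈ X.basicOpen r)
      (g : ι → Γ(X, X.basicOpen r)), ∀ i ∈ s, D.IsGenerator i (g i) := by
  obtain ⟨U, hxU, -, g, hg⟩ := D.exists_common_generators s hx
  obtain ⟨r, hr, hxr⟩ := hV.exists_basicOpen_le ⟨x, hxU⟩ hx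
  exact ⟨r, hxr, fun i => FrobeniusSplitting.res hr (g i), fun i hi => (hg i hi).res hr⟩

-- Over a small basic open with ring `S`, the coefficients of the projections of the `n` generators
-- form a matrix defining a surjection $S^n\to S^s$. Only finite subfamilies are used, so sections
-- of an infinite direct sum never need to be described.
include D in
theorem card_le (hp : p.Prime) (hX : IsOfChar X p) {V : X.Opens} (hV : IsAffineOpen V) {x : X}
    (hx : x ∈ V) {n : ℕ} (y : Fin n → Twist (frob hp hX V))
    (hy : Submodule.span Γ(X, V) (Set.range y) = ⊤) (s : Finset ι) : s.card ≤ n := by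
  obtain ⟨r, hxr, g, hg⟩ := D.exists_common_generators_basicOpen s hV hx
  let S := Γ(X, X.basicOpen r)
  have hle := X.basicOpen_le r
  have : Nonempty (X.basicOpen r) := ⟨⟨x, hxr⟩⟩
  have : Nontrivial S := X.component_nontrivial _
  have := hV.isLocalization_basicOpen r
  let y' (l : Fin n) : S := FrobeniusSplitting.res hle ((of _).symm (y l))
  have hspan : ∀ t : S, ∃ c : Fin n → S, t = ∑ l, c l ^ p * y' l := by
    intro t
    obtain ⟨m, a, ha⟩ := IsLocalization.Away.surj r t
    obtain ⟨v, hv⟩ := (IsLocalization.Away.algebraMap_isUnit r : IsUnit (algebraMap Γ(X, V) S r))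
    have ha' : FrobeniusSplitting.res hle a = t * v ^ m := by rw [hv]; exact ha.symm
    -- The factor $r^{m(p-1)}$ turns the denominator $r^m$ of `t` into the $p$-th power $r^{mp}$,
    -- which scalars can absorb.
    have hmem : of (frob hp hX V) (r ^ (m * (p - 1)) * a) ∈
        Submodule.span Γ(X, V) (Set.range y) := by rw [hy]; trivial
    obtain ⟨c, hc⟩ := (Submodule.mem_span_range_iff_exists_fun _).1 hmem
    refine ⟨fun l => ↑(v⁻¹) ^ m * FrobeniusSplitting.res hle (c l), ?_⟩
    have h1 : (v : S) ^ (m * (p - 1)) * (t * v ^ m) =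
        ∑ l, FrobeniusSplitting.res hle (c l) ^ p * y' l := by
      have h2 := congrArg (fun w => FrobeniusSplitting.res hle ((of (frob hp hX V)).symm w)) hc
      simp only [map_sum, RingEquiv.symm_apply_apply, map_mul, map_pow, ha'] at h2
      have hv' : (v : S) = FrobeniusSplitting.res hle r := hv
      rw [hv'] at h2 ⊢
      rw [← h2]
      refine Finset.sum_congr rfl fun l _ => ?_
      obtain ⟨w, hw⟩ := (of (frob hp hX V)).surjective (y l)
      simp only [y', ← hw, smul_of, RingEquiv.symm_apply_apply, map_mul, ← map_pow]
      rfl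
    have h3 : t = (↑(v⁻¹) ^ m : S) ^ p * ((v : S) ^ (m * (p - 1)) * (t * v ^ m)) := by
      obtain ⟨q, hq⟩ := Nat.exists_eq_succ_of_ne_zero hp.ne_zero
      have h4 : (↑(v⁻¹) ^ m : S) ^ p * ((v : S) ^ (m * (p - 1)) * v ^ m) = 1 := by
        rw [← pow_add, ← pow_mul, hq]
        simp only [Nat.succ_eq_add_one, Nat.add_sub_cancel]
        rw [show m * q + m = m * (q + 1) by ring, ← mul_pow, Units.inv_mul, one_pow]
      linear_combination -t * h4
    rw [h3, h1, Finset.mul_sum]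
    refine Finset.sum_congr rfl fun l _ => ?_
    ring
  choose m hm using fun (i : s) (l : Fin n) => (hg i i.2).exists_eq (y' l)
  have hsurj : Function.Surjective (Matrix.mulVecLin (Matrix.of m)) := by
    classical
    intro d
    let d' (i : ι) : S := if h : i ∈ s then d ⟨i, h⟩ else 0
    obtain ⟨c, hc⟩ := hspan (∑ i ∈ s, d' i ^ p * g i)
    refine ⟨c, funext fun i => ?_⟩
    have h1 := IsGenerator.proj_sum s hg d' i.2
    rw [hc, map_sum] at h1
    have hdi : d' i = d i := by simp [d']
    rw [hdi] at h1
    simp only [D.proj_pow_mul, hm] at h1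
    -- The equation is known only for $p$-th powers times $g_i$; freeness of the generator removes
    -- the power.
    refine sub_eq_zero.1 ((hg i i.2).eq_zero ?_)
    have h2 : (Matrix.mulVecLin (Matrix.of m) c i - d i) ^ p =
        (∑ l, c l ^ p * m i l ^ p) - d i ^ p := by
      change frob hp hX _ _ = _
      rw [map_sub]
      congr 1
      simp only [Matrix.mulVecLin_apply, Matrix.mulVec, dotProduct, Matrix.of_apply, map_sum]
      refine Finset.sum_congr rfl fun l _ => ?_
      change (m i l * c l) ^ p = _
      ring
    rw [h2, sub_mul, sub_eq_zero, ← h1, Finset.sum_mul]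
    refine Finset.sum_congr rfl fun l _ => ?_
    ring
  simpa using card_le_of_surjective S _ hsurj

variable [Fintype ι] (hsum : ∀ (V : X.Opens) (t : Γ(X, V)), ∑ i, D.proj i V t = t)

include hsum

variable {D} in
/-- Local generators of the summands form a basis of the sections of `F_* 𝒪_X`. -/
theorem finite_free_twist (hp : p.Prime) (hX : IsOfChar X p) {U : X.Opens} {g : ι → Γ(X, U)}
    (hg : ∀ i, D.IsGenerator i (g i)) : Module.Finite Γ(X, U) (Twist (frob hp hX U)) ∧
      Module.Free Γ(X, U) (Twist (frob hp hX U)) := by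
  have hsmul : ∀ c : ι → Γ(X, U), ∑ i, c i • of (frob hp hX U) (g i) =
      of (frob hp hX U) (∑ i, c i ^ p * g i) := fun c => by
    rw [map_sum]
    rfl
  have hli : LinearIndependent Γ(X, U) fun i => of (frob hp hX U) (g i) := by
    rw [Fintype.linearIndependent_iff]
    intro c hc i
    rw [hsmul] at hc
    have hc' : ∑ i, c i ^ p * g i = 0 := hc
    have := IsGenerator.proj_sum Finset.univ (fun i _ => hg i) c (Finset.mem_univ i)
    rw [hc', map_zero] at this
    exact (hg i).eq_zero this.symm
  have hspan : ⊤ ≤ Submodule.span Γ(X, U) (Set.range fun i => of (frob hp hX U) (g i)) := by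
    intro w _
    obtain ⟨t, rfl⟩ := (of (frob hp hX U)).surjective w
    choose u hu using fun i => (hg i).exists_eq t
    rw [← hsum U t, Finset.sum_congr rfl fun i _ => hu i, ← hsmul]
    exact sum_mem fun i _ => Submodule.smul_mem _ _ (Submodule.subset_span ⟨i, rfl⟩)
  let b := Module.Basis.mk hli hspan
  exact ⟨Module.Finite.of_basis b, Module.Free.of_basis b⟩

/-- The scheme `X` is reduced. -/
theorem eq_zero_of_pow_eq_zero {V : X.Opens} {u : Γ(X, V)} (hu : u ^ p = 0) :
    u = 0 := by
  refine eq_of_locally_eq _ _ fun x hx => ?_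
  obtain ⟨U, hxU, hUV, g, hg⟩ := D.exists_common_generators Finset.univ hx
  refine ⟨U, hxU, hUV, ?_⟩
  rw [map_zero]
  -- Without summands every section is an empty sum; otherwise $u^p=0$ annihilates any one
  -- generator.
  cases isEmpty_or_nonempty ι with
  | inl h =>
    rw [← hsum U (FrobeniusSplitting.res hUV u)]
    simp
  | inr h =>
    obtain ⟨i⟩ := h
    refine (hg i (Finset.mem_univ i)).eq_zero ?_
    rw [← map_pow, hu, map_zero, zero_mul]

theorem eq_zero_of_isNilpotent (hp : p.Prime) {V : X.Opens} {u : Γ(X, V)} (hu : IsNilpotent u) :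
    u = 0 := by
  obtain ⟨n, hn⟩ := hu
  have key : ∀ m, u ^ p ^ m = 0 → u = 0 := by
    intro m
    induction m with
    | zero => simp
    | succ m ih =>
      intro h
      rw [pow_succ, pow_mul] at h
      exact ih (D.eq_zero_of_pow_eq_zero hsum h)
  exact key n (pow_eq_zero_of_le (Nat.lt_pow_self hp.one_lt).le hn)

/-- If the global sections of `𝒪_X` are `p`-th powers then the projections of `1` are
idempotent. -/
theorem proj_one_isIdempotent (hp : p.Prime) (hX : IsOfChar X p)
    (hperf : ∀ a : Γ(X, ⊤), ∃ b, b ^ p = a) (i : ι) :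
    D.proj i ⊤ 1 ^ p = D.proj i ⊤ 1 ∧ D.proj i ⊤ 1 * D.proj i ⊤ 1 = D.proj i ⊤ 1 := by
  obtain ⟨b, hb⟩ := hperf (D.proj i ⊤ 1)
  -- Applying the projection again to $b^p\cdot 1$ gives $b^p\cdot b^p$, because it is linear over
  -- $p$-th powers.
  have h1 : b ^ p * b ^ p = b ^ p := by
    have := D.proj_proj i ⊤ 1
    rwa [← hb, ← mul_one (b ^ p), D.proj_pow_mul, ← hb, mul_one] at this
  have h2 : b * b = b := by
    refine sub_eq_zero.1 (D.eq_zero_of_pow_eq_zero hsum ?_)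
    change frob hp hX _ _ = 0
    rw [map_sub, sub_eq_zero]
    change (b * b) ^ p = b ^ p
    rw [mul_pow, h1]
  have h3 : b ^ p = b := (show IsIdempotentElem b from h2).pow_eq hp.ne_zero
  rw [← hb, h3, h3]
  exact ⟨rfl, h2⟩

/-- Locally, the sum of the projections weighted by the projections of `1` takes values in the
`p`-th powers. -/
theorem exists_pow_eq_sum (hp : p.Prime) (hX : IsOfChar X p)
    (hperf : ∀ a : Γ(X, ⊤), ∃ b, b ^ p = a) {V : X.Opens} {x : X} (hx : x ∈ V) :
    ∃ (W : X.Opens) (_ : x ∈ W) (_ : W ≤ V), ∀ t : Γ(X, W),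
      ∃ u, u ^ p = ∑ i, FrobeniusSplitting.res (le_top : W ≤ ⊤) (D.proj i ⊤ 1) * D.proj i W t := by
  obtain ⟨U, hxU, hUV, g, hg⟩ := D.exists_common_generators Finset.univ hx
  choose w hw using fun i => (hg i (Finset.mem_univ i)).exists_eq 1
  -- Since $1=\sum w_i^pg_i$, the germs of the $w_i$ at `x` cannot all lie in the maximal ideal.
  obtain ⟨i, hi⟩ : ∃ i, x ∈ X.basicOpen (w i) := by
    by_contra! h
    have h1 : (1 : X.presheaf.stalk x) ∈ IsLocalRing.maximalIdeal (X.presheaf.stalk x) := by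
      have h2 := congrArg (X.presheaf.germ U x hxU).hom (hsum U 1)
      rw [map_one, map_sum] at h2
      rw [← h2]
      refine Ideal.sum_mem _ fun i _ => ?_
      rw [hw, map_mul, map_pow]
      refine Ideal.mul_mem_right _ _ (Ideal.pow_mem_of_mem _ ?_ _ hp.pos)
      have h3 := h i
      rw [Scheme.mem_basicOpen _ _ _ hxU] at h3
      exact h3
    exact (Ideal.ne_top_iff_one _).1 (Ideal.IsPrime.ne_top inferInstance) h1
  set W := X.basicOpen (w i) with hW
  have hWU : W ≤ U := X.basicOpen_le _
  refine ⟨W, hi, hWU.trans hUV, fun t => ?_⟩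
  set e := fun j => FrobeniusSplitting.res (le_top : W ≤ ⊤) (D.proj j ⊤ 1) with he
  have heproj : ∀ j, e j = D.proj j W 1 := fun j => by
    rw [he]
    dsimp only
    rw [← D.proj_map, map_one]
  have hepow : ∀ j, e j ^ p = e j := fun j => by
    rw [he]
    dsimp only
    rw [← map_pow, (D.proj_one_isIdempotent hsum hp hX hperf j).1]
  have hgi := (hg i (Finset.mem_univ i)).res hWU
  set γ := FrobeniusSplitting.res hWU (g i) with hγ
  have hunit : IsUnit (FrobeniusSplitting.res hWU (w i)) :=
    RingedSpace.isUnit_res_basicOpen X.toRingedSpace (w i)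
  obtain ⟨v, hv⟩ := hunit
  have hei : e i = v ^ p * γ := by
    rw [hv, hγ, ← map_pow, ← map_mul, ← hw, ← D.proj_map, map_one, heproj]
  -- With $e_i=v^p\gamma$ and $1-e_i$ equal to its own $p$-th power,
  -- $((1-e_i)v)^p\gamma=(1-e_i)e_i=0$; the generator and the unit `v` can be cancelled.
  have hei1 : e i = 1 := by
    have h1 : ((1 - e i) * v) ^ p * γ = 0 := by
      have h2 : (1 - e i) ^ p = 1 - e i := by
        change frob hp hX _ _ = _
        rw [map_sub, map_one]
        congr 1
        exact hepow i
      rw [mul_pow, h2, mul_assoc, ← hei, sub_mul, one_mul, sub_eq_zero]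
      have := congrArg (FrobeniusSplitting.res (le_top : W ≤ ⊤))
        (D.proj_one_isIdempotent hsum hp hX hperf i).2
      rw [map_mul] at this
      exact this.symm
    have h3 := hgi.eq_zero h1
    rw [Units.mul_left_eq_zero, sub_eq_zero] at h3
    exact h3.symm
  have hej : ∀ j, j ≠ i → e j = 0 := fun j hj => by
    rw [heproj, ← hei1, heproj, D.proj_proj_of_ne hj.symm]
  obtain ⟨u, hu⟩ := hgi.exists_eq t
  refine ⟨u * ↑v⁻¹, ?_⟩
  rw [Finset.sum_eq_single_of_mem i (Finset.mem_univ i) fun j _ hj => by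
    change e j * _ = 0
    rw [hej j hj, zero_mul]]
  change _ = e i * _
  rw [hu, hei1, one_mul, mul_pow]
  congr 1
  rw [hei1] at hei
  rw [← mul_one (_ ^ p), hei, ← mul_assoc, ← mul_pow, Units.inv_mul, one_pow, one_mul]

end ProjectionData

end Projections

open Twist

/-! ### Construction of the Frobenius splitting -/

section Assembly

variable {X : Scheme.{u}} {p : ℕ}

/-- Multiplication by a global section as an endomorphism of the structure sheaf. -/
noncomputable def mulEnd (a : Γ(X, ⊤)) : structureModule X ⟶ structureModule X :=
  SheafOfModules.Hom.mk
    { app := fun V => ModuleCat.ofHom (X := ↑((PresheafOfModules.unit X.ringCatSheaf.obj).obj V))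
        (Y := ↑((PresheafOfModules.unit X.ringCatSheaf.obj).obj V))
        { toFun := fun t : Γ(X, V.unop) => res (le_top : V.unop ≤ ⊤) a * t
          map_add' := fun s t => mul_add (res (le_top : V.unop ≤ ⊤) a : Γ(X, V.unop)) s t
          map_smul' := fun s t => mul_left_comm (res (le_top : V.unop ≤ ⊤) a : Γ(X, V.unop)) s t }
      naturality := fun {V W} i => by
        refine ModuleCat.hom_ext (LinearMap.ext fun (t : Γ(X, V.unop)) => ?_)
        have h1 : res i.unop.le (res (le_top : V.unop ≤ ⊤) a * t) =
            res (le_top : W.unop ≤ ⊤) a * res i.unop.le t := by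
          rw [map_mul, res_res]
        exact h1.symm }

theorem sum_app {M N : X.Modules} {ι : Type*} (s : Finset ι) (φ : ι → (M ⟶ N)) (V : X.Opens)
    (t : Γ(M, V)) : (∑ i ∈ s, φ i).app V t = ∑ i ∈ s, (φ i).app V t := by
  classical
  induction s using Finset.induction_on with
  | empty => rfl
  | insert i s hi ih =>
    rw [Finset.sum_insert hi, Finset.sum_insert hi, ← ih]
    rfl

theorem toFrob_symm_sum (hp : p.Prime) (hX : IsOfChar X p) {ι : Type*} (s : Finset ι)
    (V : X.Opens) (t : ι → Γ(frobeniusModule hp hX, V)) :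
    (toFrob hp hX V).symm (∑ i ∈ s, t i) = ∑ i ∈ s, (toFrob hp hX V).symm (t i) :=
  map_sum _ _ _

theorem ProjectionData.ofSummands_sum {hp : p.Prime} {hX : IsOfChar X p} {ι : Type u} [Fintype ι]
    {L : ι → X.Modules} (hL : ∀ i, IsInvertible (L i)) (inc : ∀ i, L i ⟶ frobeniusModule hp hX)
    (pr : ∀ i, frobeniusModule hp hX ⟶ L i) (h1 : ∀ i, inc i ≫ pr i = 𝟙 _)
    (h2 : ∀ i j, i ≠ j → inc i ≫ pr j = 0) (h3 : ∑ i, pr i ≫ inc i = 𝟙 _) (V : X.Opens)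
    (t : Γ(X, V)) : ∑ i, (ProjectionData.ofSummands hL inc pr h1 h2).proj i V t = t := by
  have h4 := congr((toFrob hp hX V).symm
    ((Scheme.Modules.Hom.app $h3 V).hom (toFrob hp hX V t)))
  have h5 := sum_app Finset.univ (fun i => pr i ≫ inc i) V (toFrob hp hX V t)
  have h6 := toFrob_symm_sum hp hX Finset.univ V
    fun i => (pr i ≫ inc i).app V (toFrob hp hX V t)
  exact (h6.symm.trans (congrArg (toFrob hp hX V).symm h5.symm)).trans h4

/-- Two morphisms out of the structure sheaf agree if they agree on the section `1`. -/
theorem hom_ext_of_one {M : X.Modules} {φ ψ : structureModule X ⟶ M}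
    (h : ∀ V : X.Opens, φ.app V (show Γ(structureModule X, V) from (1 : Γ(X, V))) =
      ψ.app V (show Γ(structureModule X, V) from (1 : Γ(X, V)))) : φ = ψ := by
  ext V t
  have h1 : t = (show Γ(X, V) from t) • (show Γ(structureModule X, V) from (1 : Γ(X, V))) :=
    (mul_one (show Γ(X, V) from t)).symm
  rw [h1, Scheme.Modules.Hom.app_smul, Scheme.Modules.Hom.app_smul, h]

/-- A section of an `𝒪_X`-module is zero if it is locally zero. -/
theorem eq_zero_of_locally {M : X.Modules} {V : X.Opens} (s : Γ(M, V))
    (h : ∀ x ∈ V, ∃ (W : X.Opens) (_ : x ∈ W) (hW : W ≤ V),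
      M.presheaf.map (homOfLE hW).op s = 0) : s = 0 := by
  choose W hx hW hst using h
  refine TopCat.Sheaf.eq_of_locally_eq' ⟨M.presheaf, M.isSheaf⟩ (fun x : V => W x x.2) V
    (fun x => homOfLE (hW x x.2)) (fun x hx' => ?_) s 0 fun x => ?_
  · exact TopologicalSpace.Opens.mem_iSup.2 ⟨⟨x, hx'⟩, hx x hx'⟩
  · exact (hst x x.2).trans (map_zero (M.presheaf.map (homOfLE (hW x x.2)).op).hom).symm

/-- The map `F^♯` is a split monomorphism if `F_* 𝒪_X` is a finite direct sum of invertible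
sheaves and the global sections of `𝒪_X` are `p`-th powers. -/
theorem isFrobeniusSplit_of_summands (hp : p.Prime) (hX : IsOfChar X p)
    (hperf : ∀ a : Γ(X, ⊤), ∃ b, b ^ p = a) {ι : Type u} [Fintype ι] {L : ι → X.Modules}
    (hL : ∀ i, IsInvertible (L i)) (inc : ∀ i, L i ⟶ frobeniusModule hp hX)
    (pr : ∀ i, frobeniusModule hp hX ⟶ L i) (h1 : ∀ i, inc i ≫ pr i = 𝟙 _)
    (h2 : ∀ i j, i ≠ j → inc i ≫ pr j = 0) (h3 : ∑ i, pr i ≫ inc i = 𝟙 _) :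
    IsFrobeniusSplit X p hp hX := by
  let D := ProjectionData.ofSummands hL inc pr h1 h2
  have hsum := ProjectionData.ofSummands_sum hL inc pr h1 h2 h3
  let F := absFrobenius X p hp hX
  let e (i : ι) : Γ(X, ⊤) := D.proj i ⊤ 1
  let π : frobeniusModule hp hX ⟶ frobeniusModule hp hX :=
    ∑ i, (pr i ≫ inc i) ≫ (Scheme.Modules.pushforward F).map (mulEnd (e i))
  have hπ : ∀ (V : X.Opens) (t : Γ(X, V)), π.app V (toFrob hp hX V t) =
      toFrob hp hX V (∑ i, res (le_top : V ≤ ⊤) (e i) * D.proj i V t) := fun V t => by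
    rw [map_sum]
    exact sum_app Finset.univ _ V _
  have hmono : Mono (sharp F) := by
    have : Mono ((Scheme.Modules.toPresheaf X).map (sharp F)) := by
      rw [NatTrans.mono_iff_mono_app]
      intro V
      rw [AddCommGrpCat.mono_iff_injective]
      refine (injective_iff_map_eq_zero _).2 fun (t : Γ(X, V.unop)) ht => ?_
      have ht' : t ^ p = 0 := ht
      exact D.eq_zero_of_pow_eq_zero hsum ht'
    exact (Scheme.Modules.toPresheaf X).mono_of_mono_map this
  -- Vanishing in the cokernel is local, so local $p$-th roots of the values of `π` suffice and need
  -- not be glued.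
  have hfac : π ≫ cokernel.π (sharp F) = 0 := by
    ext V t
    obtain ⟨t, rfl⟩ := (toFrob hp hX V).surjective t
    refine eq_zero_of_locally _ fun x hx => ?_
    obtain ⟨W, hxW, hWV, hW⟩ := D.exists_pow_eq_sum hsum hp hX hperf hx
    refine ⟨W, hxW, hWV, ?_⟩
    rw [← naturality_app, map_toFrob]
    obtain ⟨u, hu⟩ := hW (res hWV t)
    have h4 : π.app W (toFrob hp hX W (res hWV t)) = (sharp F).app W u := by
      rw [hπ, sharp_app_eq, hu]
    have h5 := congr((Scheme.Modules.Hom.app $(cokernel.condition (sharp F)) W).hom u)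
    exact (congrArg ((cokernel.π (sharp F)).app W) h4).trans h5
  have hid : sharp F ≫ π = sharp F := by
    refine hom_ext_of_one fun V => ?_
    have h4 : (sharp F).app V (show Γ(structureModule X, V) from (1 : Γ(X, V))) =
        toFrob hp hX V 1 := (sharp_app_eq hp hX V 1).trans (by rw [one_pow])
    have h5 : π.app V (toFrob hp hX V 1) = toFrob hp hX V 1 := by
      rw [hπ]
      congr 1
      have h6 : ∀ i, D.proj i V 1 = res (le_top : V ≤ ⊤) (e i) := fun i => by
        rw [← D.proj_map, map_one (res _)]
      simp only [h6, ← map_mul, ← map_sum]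
      -- On the section $1$, `π` gives $\sum e_i^2=\sum e_i=1$.
      rw [Finset.sum_congr rfl fun i _ => (D.proj_one_isIdempotent hsum hp hX hperf i).2, hsum,
        map_one]
    have h7 := congrArg (π.app V) h4
    exact (h7.trans h5).trans h4.symm
  refine ⟨⟨⟨Abelian.monoLift (sharp F) π hfac, ?_⟩⟩⟩
  rw [← cancel_mono (sharp F), Category.assoc, Abelian.monoLift_comp, hid, Category.id_comp]

end Assembly

open Twist

/-! ### Smoothness and finiteness for schemes over the base field -/

section Geometry

variable {k : Type u} [Field k] [IsAlgClosed k] {p : ℕ} {X : Scheme.{u}}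
  (f : X ⟶ Spec (CommRingCat.of k))

/-- The structure map from the base field to the sections over an open subset. -/
noncomputable def structureMap (V : X.Opens) : k →+* Γ(X, V) :=
  (f.appLE ⊤ V le_top).hom.comp (Scheme.ΓSpecIso (CommRingCat.of k)).inv.hom

omit [IsAlgClosed k] in
theorem structureMap_finiteType [LocallyOfFiniteType f] {V : X.Opens} (hV : IsAffineOpen V) :
    (structureMap f V).FiniteType :=
  (f.finiteType_appLE (isAffineOpen_top _) hV le_top).comp
    (RingHom.FiniteType.of_surjective _ (ConcreteCategory.bijective_of_isIso
      (Scheme.ΓSpecIso (CommRingCat.of k)).inv).2)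

/-- On a nonempty scheme, only finitely many invertible sheaves occur in a decomposition of
`F_* 𝒪_X`. -/
theorem ProjectionData.finite [LocallyOfFiniteType f] {ι : Type u} (D : ProjectionData X p ι)
    (hp : p.Prime) (hX : IsOfChar X p) [Nonempty X] : Finite ι := by
  obtain ⟨x⟩ := ‹Nonempty X›
  obtain ⟨_, ⟨V, hV, rfl⟩, hxV, -⟩ :=
    X.isBasis_affineOpens.exists_subset_of_mem_open (Set.mem_univ x) isOpen_univ
  algebraize [structureMap f V]
  have : Algebra.FiniteType k Γ(X, V) := structureMap_finiteType f hV
  have : Module.Finite Γ(X, V) (Twist (frob hp hX V)) :=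
    finite_twist hp.ne_zero (fun c : k => IsAlgClosed.exists_pow_nat_eq c hp.pos) _ fun _ => rfl
  obtain ⟨n, y, hy⟩ := Module.Finite.exists_fin (R := Γ(X, V)) (M := Twist (frob hp hX V))
  by_contra h
  rw [not_finite_iff_infinite] at h
  obtain ⟨s, hs⟩ := Infinite.exists_subset_card_eq ι (n + 1)
  have := D.card_le hp hX hV hxV y hy s
  omega

/-- If `F_* 𝒪_X` is a finite direct sum of invertible sheaves then `X` is smooth. -/
theorem ProjectionData.smooth [LocallyOfFiniteType f] [CharP k p] {ι : Type u} [Fintype ι]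
    (D : ProjectionData X p ι) (hp : p.Prime) (hX : IsOfChar X p)
    (hsum : ∀ (V : X.Opens) (t : Γ(X, V)), ∑ i, D.proj i V t = t) : Smooth f := by
  have key : ∀ x : X, ∃ V : X.affineOpens, x ∈ V.1 ∧ (f.appLE ⊤ V.1 le_top).hom.Smooth := by
    intro x
    obtain ⟨_, ⟨V, hV, rfl⟩, hxV, -⟩ :=
      X.isBasis_affineOpens.exists_subset_of_mem_open (Set.mem_univ x) isOpen_univ
    obtain ⟨r, hxr, g, hg⟩ := D.exists_common_generators_basicOpen Finset.univ hV hxV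
    have hU := hV.basicOpen r
    refine ⟨⟨X.basicOpen r, hU⟩, hxr, ?_⟩
    set U := X.basicOpen r
    obtain ⟨_, _⟩ := ProjectionData.finite_free_twist hsum hp hX fun i => hg i (Finset.mem_univ i)
    have hsmooth : (structureMap f U).Smooth := by
      algebraize [structureMap f U]
      have : Algebra.FiniteType k Γ(X, U) := structureMap_finiteType f hU
      exact smooth_of_free_twist hp (frob hp hX U) fun _ => rfl
    have heq : (f.appLE ⊤ U le_top).hom =
        (structureMap f U).comp (Scheme.ΓSpecIso (CommRingCat.of k)).hom.hom := by
      rw [structureMap, RingHom.comp_assoc, ← CommRingCat.hom_comp, Iso.hom_inv_id,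
        CommRingCat.hom_id, RingHom.comp_id]
    change (f.appLE ⊤ U le_top).hom.Smooth
    rw [heq]
    exact (RingHom.Smooth.of_bijective (ConcreteCategory.bijective_of_isIso
      (Scheme.ΓSpecIso (CommRingCat.of k)).hom)).comp hsmooth
  choose V hxV hV using key
  refine HasRingHomProperty.of_iSup_eq_top V ?_ hV
  exact eq_top_iff.2 fun x _ => TopologicalSpace.Opens.mem_iSup.2 ⟨x, hxV x⟩

/-- A decomposition of `F_* 𝒪_X` into invertible sheaves can be taken to be finite. -/
theorem exists_finite_summands [LocallyOfFiniteType f] (hp : p.Prime) (hX : IsOfChar X p)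
    (h : IsDirectSumOfInvertibles (frobeniusModule hp hX)) :
    ∃ (ι : Type u) (_ : Fintype ι) (L : ι → X.Modules) (_ : ∀ i, IsInvertible (L i))
      (inc : ∀ i, L i ⟶ frobeniusModule hp hX) (pr : ∀ i, frobeniusModule hp hX ⟶ L i),
      (∀ i, inc i ≫ pr i = 𝟙 _) ∧ (∀ i j, i ≠ j → inc i ≫ pr j = 0) ∧
        ∑ i, pr i ≫ inc i = 𝟙 _ := by
  classical
  -- On the empty scheme all modules vanish, so the given index set may be infinite; it is replaced
  -- by the empty one.
  cases isEmpty_or_nonempty X with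
  | inl hemp =>
    refine ⟨PEmpty, inferInstance, fun i => i.elim, fun i => i.elim, fun i => i.elim,
      fun i => i.elim, fun i => i.elim, fun i => i.elim, ?_⟩
    ext V t
    obtain ⟨s, rfl⟩ := (toFrob hp hX V).surjective t
    have h1 : s = 0 := eq_of_locally_eq _ _ fun x _ => isEmptyElim x
    rw [h1, map_zero, map_zero, map_zero]
  | inr hne =>
    obtain ⟨ι, L, hL, ⟨e⟩⟩ := h
    let inc (i : ι) : L i ⟶ frobeniusModule hp hX := Sigma.ι L i ≫ e.inv
    let pr (i : ι) : frobeniusModule hp hX ⟶ L i := e.hom ≫ Sigma.π L i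
    have h1 : ∀ i, inc i ≫ pr i = 𝟙 _ := fun i => by
      simp [inc, pr]
    have h2 : ∀ i j, i ≠ j → inc i ≫ pr j = 0 := fun i j hij => by
      simp only [inc, pr, Category.assoc, Iso.inv_hom_id_assoc, Sigma.ι_π, dif_neg hij]
    have : Finite ι := (ProjectionData.ofSummands hL inc pr h1 h2).finite f hp hX
    let : Fintype ι := Fintype.ofFinite ι
    refine ⟨ι, inferInstance, L, hL, inc, pr, h1, h2, ?_⟩
    rw [← cancel_epi e.inv]
    refine Sigma.hom_ext _ _ fun i => ?_
    have h3 : inc i ≫ ∑ j, pr j ≫ inc j = inc i := by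
      rw [Preadditive.comp_sum, Finset.sum_eq_single_of_mem i (Finset.mem_univ i) fun j _ hj => by
        rw [reassoc_of% h2 i j hj.symm, zero_comp], reassoc_of% h1 i]
    rw [Category.comp_id, ← Category.assoc]
    exact h3

end Geometry

end FrobeniusSplitting

open FrobeniusSplitting in
theorem mainTheorem4 {k : Type u} [Field k] [IsAlgClosed k] (p : ℕ) (hp : p.Prime) [CharP k p]
    (X : Scheme.{u}) (f : X ⟶ Spec (CommRingCat.of k)) [IsProper f]
    (h : IsDirectSumOfInvertibles
      ((Scheme.Modules.pushforward (absFrobenius X p hp (IsOfChar.of_field f))).obj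
        (structureModule X))) :
    Smooth f ∧ IsFrobeniusSplit X p hp (IsOfChar.of_field f) := by
  have hX : IsOfChar X p := IsOfChar.of_field f
  obtain ⟨ι, _, L, hL, inc, pr, h1, h2, h3⟩ := exists_finite_summands f hp hX h
  have hsum := ProjectionData.ofSummands_sum hL inc pr h1 h2 h3
  refine ⟨ProjectionData.smooth f _ hp hX hsum,
    isFrobeniusSplit_of_summands hp hX (fun a => ?_) hL inc pr h1 h2 h3⟩
  algebraize [structureMap f ⊤]
  refine exists_pow_eq_of_isIntegral (k := k) hp
    (fun b hb => ProjectionData.eq_zero_of_isNilpotent _ hsum hp hb) a ?_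
  -- Properness enters here: universal closedness makes the global sections integral over `k`.
  have hint : (structureMap f ⊤).IsIntegral := by
    have h4 := isIntegral_appTop_of_universallyClosed f
    rw [Scheme.Hom.appTop, Scheme.Hom.app_eq_appLE] at h4
    refine RingHom.IsIntegral.trans _ _ (RingHom.isIntegral_of_surjective _
      (ConcreteCategory.bijective_of_isIso (Scheme.ΓSpecIso (CommRingCat.of k)).inv).2) ?_
    exact h4
  exact hint a
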